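/- Let $\alpha,\beta:\mathbb Z_+^2\to(0,\infty)$ be bounded and let $\mathbf T=(T_1,T_2)$ be the $2$-variable weighted shift on $\ell^2(\mathbb Z_+^2)$ given by $T_1e_{\mathbf k}=\alpha_{\mathbf k}e_{\mathbf k+(1,0)}$, $T_2e_{\mathbf k}=\beta_{\mathbf k}e_{\mathbf k+(0,1)}$. Assume that $T_1T_2=T_2T_1$ and that $T_1$ and $T_2$ are each subnormal (the restriction of a normal operator to an invariant subspace). Assume also that $\mathbf T$ is flat, normalized so that the core has Berger measure $\delta_1\times\delta_{b^2}$: $\alpha_{(k_1,k_2)}=1$ and $\beta_{(k_1,k_2)}=b$ for all $k_1,k_2\ge1$. Put $a:=\alpha_{(0,1)}$ and $y_0:=\beta_{(0,0)}$. The Berger measure of a weighted shift $W$ in one variable with weights $w_0,w_1,\dots$ is the probability measure on $[0,\|W\|^2]$ with moments $w_0^2\cdots w_{k-1}^2$ $(k\ge0)$. The Berger measure of $\mathbf T$ is the probability measure $\mu$ on $[0,\|T_1\|^2]\times[0,\|T_2\|^2]$ with $\int s^{k_1}t^{k_2}\,d\mu(s,t)=\prod_{i<k_1}\alpha_{(i,0)}^2\prod_{j<k_2}\beta_{(k_1,j)}^2$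 for all $k_1,k_2\ge0$. Let $\xi_x$, $\eta_y$ and $(\eta_y)_1$ be the Berger measures of the shifts with weights $(\alpha_{(n,0)})_{n\ge0}$, $(\beta_{(0,n)})_{n\ge0}$ and $(\beta_{(0,n+1)})_{n\ge0}$, respectively, and let $m:=\eta_y(\{b^2\})$. For a finite signed measure $\nu$ on $\mathbb R$ write $\|1/t\|_{L^1(\nu)}=\int|1/t|\,d|\nu|(t)$ and $d\widetilde\nu(t)=\dfrac{d\nu(t)}{t\,\|1/t\|_{L^1(\nu)}}$ (with $\widetilde\nu=0$ if $\nu=0$). With $\xi=\delta_1$ and $\eta=\delta_{b^2}$ define the signed measures $$\psi:=(\eta_y)_1-a^2\left\|\tfrac1s\right\|_{L^1(\xi)}\eta,\qquad \varphi:=\xi_x-y_0^2\left\|\tfrac1t\right\|_{L^1(\psi)}\delta_0-a^2y_0^2\left\|\tfrac1s\right\|_{L^1(\xi)}\left\|\tfrac1t\right\|_{L^1(\eta)}\widetilde\xi .$$ Then the following statements are equivalent: (i) $\mathbf T$ is subnormal, that is, $(T_1,T_2)$ is the restriction of a commuting pair of normal operators to a common invariant subspace; (ii) $\psi$ and $\varphi$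 are positive measures; (iii) $\dfrac ba\sqrt m\ge y_0$ and $\xi_x\ge y_0^2\left\{\left(\left\|\tfrac1t\right\|_{L^1((\eta_y)_1)}-\tfrac{a^2}{b^2}\right)\delta_0+\tfrac{a^2}{b^2}\delta_1\right\}$. Moreover, when $\mathbf T$ is subnormal, its Berger measure exists, is unique, and is $$\mu=\varphi\times(\delta_0-\delta_{b^2})+y_0^2\left\|\tfrac1t\right\|_{L^1(\psi)}\,\delta_0\times(\widetilde\psi-\delta_{b^2})+\xi_x\times\delta_{b^2}.$$ -/

import Mathlib

open MeasureTheory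

noncomputable section

/-- The complex Hilbert space `ℓ²(ι)`. -/
abbrev EllTwo (ι : Type) : Type := lp (fun _ : ι => ℂ) 2

/-- The canonical orthonormal basis vector `e_i` of `ℓ²(ι)`. -/
def basisVec {ι : Type} [DecidableEq ι] (i : ι) : EllTwo ι :=
  lp.single (E := fun _ : ι => ℂ) 2 i (1 : ℂ)

/-- Weights: bounded families of positive real numbers indexed by `ι`. -/
structure Weights (ι : Type) where
  toFun : ι → ℝ
  pos : ∀ i, 0 < toFun i
  bdd : ∃ C : ℝ, ∀ i, toFun i ≤ C

instance {ι : Type} : CoeFun (Weights ι) (fun _ => ι → ℝ) := ⟨Weights.toFun⟩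

/-- Reindexing of a weight family, used for rows, columns and tails of a weight diagram. -/
def Weights.reindex {ι κ : Type} (w : Weights ι) (f : κ → ι) : Weights κ where
  toFun k := w (f k)
  pos k := w.pos (f k)
  bdd := w.bdd.imp fun _ hC k => hC (f k)

/-- The diagonal operator `e_i ↦ w_i e_i` on `ℓ²(ι)`. -/
def diagonalOp {ι : Type} (w : Weights ι) : EllTwo ι →L[ℂ] EllTwo ι :=
  lp.mapCLM 2 (K := max w.bdd.choose 0)
    (fun i => ((w i : ℝ) : ℂ) • ContinuousLinearMap.id ℂ ℂ) (le_max_right _ _) (by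
      intro i
      rw [norm_smul, Complex.norm_real, Real.norm_of_nonneg (w.pos i).le]
      refine (mul_le_of_le_one_right (w.pos i).le ContinuousLinearMap.norm_id_le).trans ?_
      exact (w.bdd.choose_spec i).trans (le_max_left _ _))

theorem orthonormal_basisVec {ι : Type} [DecidableEq ι] :
    Orthonormal ℂ (basisVec : ι → EllTwo ι) := by
  rw [orthonormal_iff_ite]
  intro i j
  simp only [basisVec, lp.inner_single_left, lp.single_apply, Pi.single_apply]
  split_ifs <;> simp_all

/-- The isometry `e_i ↦ e_{σ i}` of `ℓ²(ι)` attached to an injection `σ` of the index set. -/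
def basisIsometry {ι : Type} [DecidableEq ι] (σ : ι ↪ ι) : EllTwo ι →ₗᵢ[ℂ] EllTwo ι :=
  ((orthonormal_basisVec (ι := ι)).comp σ σ.injective).orthogonalFamily.linearIsometry

/-- The weighted shift `e_i ↦ w_i e_{σ i}`. -/
def weightedShift {ι : Type} [DecidableEq ι] (w : Weights ι) (σ : ι ↪ ι) :
    EllTwo ι →L[ℂ] EllTwo ι :=
  (basisIsometry σ).toContinuousLinearMap ∘L diagonalOp w

theorem weightedShift_basisVec {ι : Type} [DecidableEq ι] (w : Weights ι) (σ : ι ↪ ι) (i : ι) :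
    weightedShift w σ (basisVec i) = ((w i : ℝ) : ℂ) • basisVec (σ i) := by
  have h : diagonalOp w (basisVec i) = lp.single (E := fun _ : ι => ℂ) 2 i ((w i : ℝ) : ℂ) := by
    ext j
    by_cases hj : j = i
    · subst hj
      simp [diagonalOp, basisVec, lp.single_apply]
    · simp [diagonalOp, basisVec, lp.single_apply, hj]
  change basisIsometry σ (diagonalOp w (basisVec i)) = _
  rw [h, basisIsometry, OrthogonalFamily.linearIsometry_apply_single]
  rfl

/-- `n ↦ n + 1`. -/
def succEmb : ℕ ↪ ℕ := ⟨fun n => n + 1, fun _ _ h => Nat.succ_injective h⟩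

/-- `k ↦ k + ε₁`. -/
def eastEmb : ℕ × ℕ ↪ ℕ × ℕ := ⟨fun k => (k.1 + 1, k.2), fun k l h => by
  simpa [Prod.ext_iff] using h⟩

/-- `k ↦ k + ε₂`. -/
def northEmb : ℕ × ℕ ↪ ℕ × ℕ := ⟨fun k => (k.1, k.2 + 1), fun k l h => by
  simpa [Prod.ext_iff] using h⟩

/-- The unilateral weighted shift `shift(w 0, w 1, …)` on `ℓ²(ℕ)`. -/
def uniShift (w : Weights ℕ) : EllTwo ℕ →L[ℂ] EllTwo ℕ := weightedShift w succEmb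

/-- First component of a 2-variable weighted shift: `T₁ e_k = α_k e_{k+ε₁}`. -/
def shiftOne (α : Weights (ℕ × ℕ)) : EllTwo (ℕ × ℕ) →L[ℂ] EllTwo (ℕ × ℕ) :=
  weightedShift α eastEmb

/-- Second component of a 2-variable weighted shift: `T₂ e_k = β_k e_{k+ε₂}`. -/
def shiftTwo (β : Weights (ℕ × ℕ)) : EllTwo (ℕ × ℕ) →L[ℂ] EllTwo (ℕ × ℕ) :=
  weightedShift β northEmb

/-- `T` is subnormal: the restriction of a normal operator to an invariant subspace
(`H` being identified with its image under the isometry `V`). -/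
def IsSubnormal {H : Type} [NormedAddCommGroup H] [InnerProductSpace ℂ H] (T : H →L[ℂ] H) :
    Prop :=
  ∃ (K : Type) (_ : NormedAddCommGroup K) (_ : InnerProductSpace ℂ K) (_ : CompleteSpace K)
    (V : H →ₗᵢ[ℂ] K) (N : K →L[ℂ] K), IsStarNormal N ∧ ∀ x, N (V x) = V (T x)

/-- `(T₁, T₂)` is (jointly) subnormal: the restriction of a commuting pair of normal operators
to a common invariant subspace. -/
def IsSubnormalPair {H : Type} [NormedAddCommGroup H] [InnerProductSpace ℂ H]
    (T₁ T₂ : H →L[ℂ] H) : Prop :=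
  ∃ (K : Type) (_ : NormedAddCommGroup K) (_ : InnerProductSpace ℂ K) (_ : CompleteSpace K)
    (V : H →ₗᵢ[ℂ] K) (N₁ N₂ : K →L[ℂ] K), IsStarNormal N₁ ∧ IsStarNormal N₂ ∧ Commute N₁ N₂ ∧
      (∀ x, N₁ (V x) = V (T₁ x)) ∧ ∀ x, N₂ (V x) = V (T₂ x)

/-- The class `𝔥₀` of commuting pairs of subnormal operators. -/
def IsCommutingSubnormals {H : Type} [NormedAddCommGroup H] [InnerProductSpace ℂ H]
    (T₁ T₂ : H →L[ℂ] H) : Prop :=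
  Commute T₁ T₂ ∧ IsSubnormal T₁ ∧ IsSubnormal T₂

/-- `ν` is the Berger measure of `shift(w 0, w 1, …)`: a probability measure carried by
`[0, ‖W‖²]` whose moments are `(w 0)² ⋯ (w (k-1))²`. -/
def IsBergerMeasure (w : Weights ℕ) (ν : ProbabilityMeasure ℝ) : Prop :=
  (ν : Measure ℝ) (Set.Icc 0 (‖uniShift w‖ ^ 2))ᶜ = 0 ∧
    ∀ k : ℕ, ∫ s, s ^ k ∂(ν : Measure ℝ) = ∏ i ∈ Finset.range k, w i ^ 2

/-- The moment of order `k` of a 2-variable weighted shift (computed along row `0`, and then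
up column `k₁`). -/
def moment (α β : Weights (ℕ × ℕ)) (k : ℕ × ℕ) : ℝ :=
  (∏ i ∈ Finset.range k.1, α (i, 0) ^ 2) * ∏ j ∈ Finset.range k.2, β (k.1, j) ^ 2

/-- `μ` is the Berger measure of the 2-variable weighted shift with weights `α`, `β`: a
probability measure carried by `[0, ‖T₁‖²] × [0, ‖T₂‖²]` that interpolates all moments. -/
def IsBergerMeasureTwo (α β : Weights (ℕ × ℕ)) (μ : ProbabilityMeasure (ℝ × ℝ)) : Prop :=
  (μ : Measure (ℝ × ℝ))
      (Set.Icc 0 (‖shiftOne α‖ ^ 2) ×ˢ Set.Icc 0 (‖shiftTwo β‖ ^ 2))ᶜ = 0 ∧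
    ∀ k : ℕ × ℕ, ∫ p, p.1 ^ k.1 * p.2 ^ k.2 ∂(μ : Measure (ℝ × ℝ)) = moment α β k

/-- Horizontally flat: `α_k = α_{(1,1)}` for all `k₁, k₂ ≥ 1`. -/
def IsHorizontallyFlat (α : Weights (ℕ × ℕ)) : Prop :=
  ∀ k₁ k₂ : ℕ, 1 ≤ k₁ → 1 ≤ k₂ → α (k₁, k₂) = α (1, 1)

/-- Vertically flat: `β_k = β_{(1,1)}` for all `k₁, k₂ ≥ 1`. -/
def IsVerticallyFlat (β : Weights (ℕ × ℕ)) : Prop :=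
  ∀ k₁ k₂ : ℕ, 1 ≤ k₁ → 1 ≤ k₂ → β (k₁, k₂) = β (1, 1)

/-- A probability measure, seen as a signed measure. -/
def toSigned {X : Type} [MeasurableSpace X] (ν : ProbabilityMeasure X) : SignedMeasure X :=
  (ν : Measure X).toSignedMeasure

/-- The unit point mass at `x`, as a signed measure. -/
def pointMass (x : ℝ) : SignedMeasure ℝ := (Measure.dirac x).toSignedMeasure

/-- `‖1/t‖_{L¹(ν)}`, the integral of `|1/t|` against the total variation of `ν`. -/
def normInv (ν : SignedMeasure ℝ) : ℝ := (∫⁻ t, ‖t‖ₑ⁻¹ ∂ν.variation).toReal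

/-- The measure `dν̃(t) = dν(t) / (t ‖1/t‖_{L¹(ν)})`; it is `0` for `ν = 0`. -/
def tilde (ν : SignedMeasure ℝ) : SignedMeasure ℝ :=
  ν.withDensity (fun t : ℝ => 1 / (t * normInv ν)) (ContinuousLinearMap.mul ℝ ℝ)

/-- The product of two signed measures on the line. -/
def times (ν ρ : SignedMeasure ℝ) : SignedMeasure (ℝ × ℝ) :=
  ν.prod ρ (ContinuousLinearMap.mul ℝ ℝ)

theorem isFiniteMeasure_variation (ν : SignedMeasure ℝ) : IsFiniteMeasure ν.variation := by
  rw [← SignedMeasure.totalVariation_eq_variation, SignedMeasure.totalVariation]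
  infer_instance

theorem times_apply (ν ρ : SignedMeasure ℝ) (s t : Set ℝ) : times ν ρ (s ×ˢ t) = ν s * ρ t := by
  have := isFiniteMeasure_variation ν
  simp [times]

/-- `ψ = (η_y)₁ - a² ‖1/s‖_{L¹(ξ)} η`. -/
def psi (a : ℝ) (ηy₁ ξ η : SignedMeasure ℝ) : SignedMeasure ℝ :=
  ηy₁ - (a ^ 2 * normInv ξ) • η

/-- `φ = ξ_x - y₀² ‖1/t‖_{L¹(ψ)} δ₀ - a² y₀² ‖1/s‖_{L¹(ξ)} ‖1/t‖_{L¹(η)} ξ̃`. -/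
def phi (a y₀ : ℝ) (ξx ψ ξ η : SignedMeasure ℝ) : SignedMeasure ℝ :=
  ξx - (y₀ ^ 2 * normInv ψ) • pointMass 0
    - (a ^ 2 * y₀ ^ 2 * normInv ξ * normInv η) • tilde ξ

end

/-! ### Weighted shifts: norms, commutation, moments -/

noncomputable section

/-! Write d = b² and c = a² y₀² / b². Flatness makes every moment of order (i + 1, j + 1) equal to c
d^(j+1), so for a representing measure μ the measure s t dμ is a multiple of the point mass at (1,
d). Hence μ lives on the two axes and that point: μ = τ × δ₀ + δ₀ × σ + c δ_(1,d), with σ on the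
positive axis. Comparing marginals, η_y restricted to (0, ∞) is σ + c δ_d, and ξ_x is τ + e δ₀ + c
δ₁ with e = η_y((0, ∞)) - c the mass of σ. Such τ and σ exist exactly when c ≤ η_y({d}), c ≤
ξ_x({1}) and e ≤ ξ_x({0}). Conditions (ii) and (iii) both unwind to these three inequalities.

Necessity does not construct μ from the operators. In a normal extension, A = N₁*N₁ and B = N₂*N₂
are commuting self-adjoint operators, and v = V e_(0,0) gives ⟨v, f(A)² g(B)² v⟩ ≥ 0 for real
polynomials f, g. This number depends only on the moments (`inner_realAeval`); letting f or g peak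
at a suitable point yields the three inequalities (`atoms_of_isSubnormalPair`).

Sufficiency assembles μ from the splittings (`crossMeasure`) and attaches independent uniform phases
to √s and √t. Multiplication by the two resulting functions on L² is a commuting normal extension
(`isSubnormalPair_of_moments`).

The signed-measure formula rests on the density t / y₀² of (η_y)₁ against η_y on (0, ∞): ψ has the
same density against σ, so y₀² ‖1/t‖_{L¹(ψ)} = e, e ψ̃ = σ and φ = τ. Uniqueness of μ is
Stone–Weierstrass on a compact rectangle. -/

theorem ext_basisVec {ι : Type} [DecidableEq ι] {E : Type*} [NormedAddCommGroup E]
    [NormedSpace ℂ E] {f g : EllTwo ι →L[ℂ] E} (h : ∀ i, f (basisVec i) = g (basisVec i)) :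
    f = g := by
  refine lp.ext_continuousLinearMap (ENNReal.ofNat_ne_top (n := nat_lit 2)) fun i => ?_
  ext
  simpa [basisVec] using h i

/-- The isometry `e_i ↦ v_i` attached to an orthonormal family. -/
def isometryOfOrthonormal {ι : Type} [DecidableEq ι] {K : Type} [NormedAddCommGroup K]
    [InnerProductSpace ℂ K] [CompleteSpace K] {v : ι → K} (hv : Orthonormal ℂ v) :
    EllTwo ι →ₗᵢ[ℂ] K :=
  hv.orthogonalFamily.linearIsometry

theorem isometryOfOrthonormal_basisVec {ι : Type} [DecidableEq ι] {K : Type}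
    [NormedAddCommGroup K] [InnerProductSpace ℂ K] [CompleteSpace K] {v : ι → K}
    (hv : Orthonormal ℂ v) (i : ι) : isometryOfOrthonormal hv (basisVec i) = v i := by
  rw [isometryOfOrthonormal, basisVec, OrthogonalFamily.linearIsometry_apply_single]
  simp

theorem norm_basisVec {ι : Type} [DecidableEq ι] (i : ι) : ‖(basisVec i : EllTwo ι)‖ = 1 :=
  orthonormal_basisVec.1 i

theorem basisVec_ne_zero {ι : Type} [DecidableEq ι] (i : ι) : (basisVec i : EllTwo ι) ≠ 0 :=
  orthonormal_basisVec.ne_zero i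

theorem weight_le_norm_weightedShift {ι : Type} [DecidableEq ι] (w : Weights ι) (σ : ι ↪ ι)
    (i : ι) : w i ≤ ‖weightedShift w σ‖ := by
  have h := (weightedShift w σ).le_opNorm (basisVec i)
  rwa [weightedShift_basisVec, norm_smul, norm_basisVec, norm_basisVec, Complex.norm_real,
    Real.norm_of_nonneg (w.pos i).le, mul_one, mul_one] at h

/-- The isometry e_k ↦ e_(f k) intertwines the two shifts. This places the supports of the row and
column Berger measures inside [0, ‖T₁‖²] and [0, ‖T₂‖²]. -/
theorem norm_weightedShift_reindex_le {ι κ : Type} [DecidableEq ι] [DecidableEq κ]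
    (w : Weights ι) (σ : ι ↪ ι) (τ : κ ↪ κ) (f : κ → ι) (hf : Function.Injective f)
    (h : ∀ k, f (τ k) = σ (f k)) :
    ‖weightedShift (w.reindex f) τ‖ ≤ ‖weightedShift w σ‖ := by
  let J := isometryOfOrthonormal ((orthonormal_basisVec (ι := ι)).comp f hf)
  have hJ : ∀ k, J (basisVec k) = basisVec (f k) := isometryOfOrthonormal_basisVec _
  have key : J.toContinuousLinearMap ∘L weightedShift (w.reindex f) τ
      = weightedShift w σ ∘L J.toContinuousLinearMap := by
    refine ext_basisVec fun k => ?_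
    simp only [ContinuousLinearMap.comp_apply, LinearIsometry.coe_toContinuousLinearMap,
      weightedShift_basisVec, map_smul, hJ, h]
    rfl
  refine ContinuousLinearMap.opNorm_le_bound _ (norm_nonneg _) fun x => ?_
  have hx := congrArg norm (congrArg (fun F => F x) key)
  simp only [ContinuousLinearMap.comp_apply, LinearIsometry.coe_toContinuousLinearMap,
    LinearIsometry.norm_map] at hx
  rw [hx]
  simpa using (weightedShift w σ).le_opNorm (J x)

theorem norm_uniShift_row_le (α : Weights (ℕ × ℕ)) (j : ℕ) :
    ‖uniShift (α.reindex fun n => (n, j))‖ ≤ ‖shiftOne α‖ :=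
  norm_weightedShift_reindex_le α eastEmb succEmb _ (fun _ _ h => (Prod.ext_iff.1 h).1)
    fun _ => rfl

theorem norm_uniShift_column_le (β : Weights (ℕ × ℕ)) (i : ℕ) :
    ‖uniShift (β.reindex fun n => (i, n))‖ ≤ ‖shiftTwo β‖ :=
  norm_weightedShift_reindex_le β northEmb succEmb _ (fun _ _ h => (Prod.ext_iff.1 h).2)
    fun _ => rfl

theorem shiftOne_basisVec (α : Weights (ℕ × ℕ)) (i j : ℕ) :
    shiftOne α (basisVec (i, j)) = ((α (i, j) : ℝ) : ℂ) • basisVec (i + 1, j) :=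
  weightedShift_basisVec _ _ _

theorem shiftTwo_basisVec (β : Weights (ℕ × ℕ)) (i j : ℕ) :
    shiftTwo β (basisVec (i, j)) = ((β (i, j) : ℝ) : ℂ) • basisVec (i, j + 1) :=
  weightedShift_basisVec _ _ _

theorem weights_commute {α β : Weights (ℕ × ℕ)} (h : Commute (shiftOne α) (shiftTwo β))
    (i j : ℕ) : α (i, j) * β (i + 1, j) = β (i, j) * α (i, j + 1) := by
  have h1 := congrArg (fun F => F (basisVec (i, j))) h.eq
  simp only [mul_apply_eq_comp, shiftOne_basisVec, shiftTwo_basisVec, map_smul,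
    smul_smul] at h1
  have h2 := smul_left_injective ℂ (basisVec_ne_zero (i + 1, j + 1)) h1
  have h3 : β (i, j) * α (i, j + 1) = α (i, j) * β (i + 1, j) := by exact_mod_cast h2
  exact h3.symm

theorem moment_pos (α β : Weights (ℕ × ℕ)) (k : ℕ × ℕ) : 0 < moment α β k :=
  mul_pos (Finset.prod_pos fun _ _ => pow_pos (α.pos _) 2)
    (Finset.prod_pos fun _ _ => pow_pos (β.pos _) 2)

theorem moment_north (α β : Weights (ℕ × ℕ)) (i j : ℕ) :
    moment α β (i, j + 1) = β (i, j) ^ 2 * moment α β (i, j) := by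
  simp only [moment, Finset.prod_range_succ]
  ring

/-- Commutativity makes moments independent of the lattice path. They are defined by a path that
goes east only along row 0, hence the induction on the height. -/
theorem moment_east {α β : Weights (ℕ × ℕ)} (h : Commute (shiftOne α) (shiftTwo β)) (i j : ℕ) :
    moment α β (i + 1, j) = α (i, j) ^ 2 * moment α β (i, j) := by
  induction j with
  | zero => simp only [moment, Finset.prod_range_succ, Finset.prod_range_zero]; ring
  | succ j ih =>
    rw [moment_north, moment_north, ih]
    have := weights_commute h i j
    calc β (i + 1, j) ^ 2 * (α (i, j) ^ 2 * moment α β (i, j))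
        = (α (i, j) * β (i + 1, j)) ^ 2 * moment α β (i, j) := by ring
      _ = _ := by rw [this]; ring

theorem moment_row_zero (α β : Weights (ℕ × ℕ)) (i : ℕ) :
    moment α β (i, 0) = ∏ n ∈ Finset.range i, α (n, 0) ^ 2 := by
  simp [moment]

theorem moment_column_zero (α β : Weights (ℕ × ℕ)) (j : ℕ) :
    moment α β (0, j) = ∏ n ∈ Finset.range j, β (0, n) ^ 2 := by
  simp [moment]

/-- Off the axes the moments are those of a mass a² y₀² / b² at (1, b²). The division by b²
compensates for the first vertical step, whose weight is y₀ and not b. -/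
theorem moment_core {α β : Weights (ℕ × ℕ)} (hαflat : IsHorizontallyFlat α)
    (hβflat : IsVerticallyFlat β) (hα : α (1, 1) = 1)
    (h : Commute (shiftOne α) (shiftTwo β)) (i j : ℕ) :
    moment α β (i + 1, j + 1)
      = α (0, 1) ^ 2 * β (0, 0) ^ 2 / β (1, 1) ^ 2 * (β (1, 1) ^ 2) ^ (j + 1) := by
  have hb := (β.pos (1, 1)).ne'
  induction j with
  | zero =>
    have h1 : moment α β (i + 1, 1) = α (0, 1) ^ 2 * β (0, 0) ^ 2 := by
      induction i with
      | zero =>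
        rw [moment_east h, moment_north]
        simp [moment]
      | succ i ih => rw [moment_east h, hαflat _ _ (by omega) (by omega), hα, ih]; simp
    rw [h1]
    field_simp
    simp
  | succ j ih => rw [moment_north, hβflat _ _ (by omega) (by omega), ih]; ring

/-! ### Subnormality from a representing measure -/

/-- Multiplication by an essentially bounded function on `L²`. -/
def mulOp {Ω : Type} [MeasurableSpace Ω] {P : Measure Ω} {z : Ω → ℂ} (hz : MemLp z ⊤ P) :
    Lp ℂ 2 P →L[ℂ] Lp ℂ 2 P :=
  (ContinuousLinearMap.mul ℂ ℂ).holderL P ⊤ 2 2 hz.toLp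

theorem coeFn_mulOp {Ω : Type} [MeasurableSpace Ω] {P : Measure Ω} {z : Ω → ℂ}
    (hz : MemLp z ⊤ P) (g : Lp ℂ 2 P) : mulOp hz g =ᵐ[P] fun x => z x * g x := by
  have h := (ContinuousLinearMap.mul ℂ ℂ).coeFn_holder (r := 2) hz.toLp g
  filter_upwards [h, hz.coeFn_toLp] with x h1 h2
  rw [mulOp, ContinuousLinearMap.holderL_apply_apply, h1, h2]
  rfl

theorem commute_mulOp {Ω : Type} [MeasurableSpace Ω] {P : Measure Ω} {z w : Ω → ℂ}
    (hz : MemLp z ⊤ P) (hw : MemLp w ⊤ P) : Commute (mulOp hz) (mulOp hw) := by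
  refine ContinuousLinearMap.ext fun g => Lp.ext ?_
  rw [mul_apply_eq_comp, mul_apply_eq_comp]
  filter_upwards [coeFn_mulOp hz (mulOp hw g), coeFn_mulOp hw (mulOp hz g), coeFn_mulOp hz g,
    coeFn_mulOp hw g] with x h1 h2 h3 h4
  rw [h1, h2, h3, h4]
  ring

theorem star_mulOp {Ω : Type} [MeasurableSpace Ω] {P : Measure Ω} {z : Ω → ℂ}
    (hz : MemLp z ⊤ P) (hz' : MemLp (fun x => star (z x)) ⊤ P) :
    star (mulOp hz) = mulOp hz' := by
  rw [ContinuousLinearMap.star_eq_adjoint, eq_comm, ContinuousLinearMap.eq_adjoint_iff]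
  intro f g
  rw [L2.inner_def, L2.inner_def]
  refine integral_congr_ae ?_
  filter_upwards [coeFn_mulOp hz' f, coeFn_mulOp hz g] with x h1 h2
  rw [h1, h2]
  simp only [RCLike.inner_apply, map_mul, RCLike.star_def, RingHomCompTriple.comp_apply,
    RingHom.id_apply]
  ring

theorem isStarNormal_mulOp {Ω : Type} [MeasurableSpace Ω] {P : Measure Ω} {z : Ω → ℂ}
    (hz : MemLp z ⊤ P) : IsStarNormal (mulOp hz) :=
  ⟨by rw [star_mulOp hz hz.star]; exact commute_mulOp _ _⟩

/-- A pair of commuting weighted shifts whose moments are the `L²` norms of the monomials in a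
pair of bounded functions with orthogonal monomials is subnormal. -/
theorem isSubnormalPair_of_orthogonal_monomials {α β : Weights (ℕ × ℕ)}
    (hT : Commute (shiftOne α) (shiftTwo β)) {Ω : Type} [MeasurableSpace Ω] {P : Measure Ω}
    [IsFiniteMeasure P] {z w : Ω → ℂ} (hz : MemLp z ⊤ P) (hw : MemLp w ⊤ P)
    (horth : ∀ k l : ℕ × ℕ, ∫ x, star (z x ^ k.1 * w x ^ k.2) * (z x ^ l.1 * w x ^ l.2) ∂P
      = if k = l then ((moment α β k : ℝ) : ℂ) else 0) :
    IsSubnormalPair (shiftOne α) (shiftTwo β) := by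
  have hmem : ∀ k : ℕ × ℕ, MemLp (fun x => z x ^ k.1 * w x ^ k.2) 2 P := by
    intro k
    have h : MemLp ((fun x => z x ^ k.1) * fun x => w x ^ k.2) ⊤ P := by
      have hp : ∀ {u : Ω → ℂ} (_ : MemLp u ⊤ P) (n : ℕ), MemLp (fun x => u x ^ n) ⊤ P := by
        intro u hu n
        induction n with
        | zero => simpa using memLp_const (1 : ℂ)
        | succ n ih => simpa only [pow_succ] using MemLp.mul' (r := ⊤) hu ih
      exact MemLp.mul (r := ⊤) (hp hw _) (hp hz _)
    exact h.mono_exponent le_top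
  -- The normalized monomials are orthonormal; e_k ↦ v k embeds the shifts into multiplication by z
  -- and w.
  let v : ℕ × ℕ → Lp ℂ 2 P := fun k => ((√(moment α β k))⁻¹ : ℂ) • (hmem k).toLp
  have hv : Orthonormal ℂ v := by
    rw [orthonormal_iff_ite]
    intro k l
    have h1 : inner ℂ (hmem k).toLp (hmem l).toLp
        = if k = l then ((moment α β k : ℝ) : ℂ) else 0 := by
      rw [L2.inner_def, ← horth]
      refine integral_congr_ae ?_
      filter_upwards [(hmem k).coeFn_toLp, (hmem l).coeFn_toLp] with x h1 h2
      rw [h1, h2, RCLike.inner_apply, mul_comm]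
      rfl
    simp only [v, inner_smul_left, inner_smul_right, h1]
    split_ifs with hkl
    · subst hkl
      have hpos := moment_pos α β k
      have hs : (√(moment α β k) : ℂ) ≠ 0 := by
        exact_mod_cast (Real.sqrt_pos.2 hpos).ne'
      have hsq : ((moment α β k : ℝ) : ℂ) = (√(moment α β k) : ℂ) * (√(moment α β k) : ℂ) := by
        exact_mod_cast (Real.mul_self_sqrt hpos.le).symm
      rw [hsq]
      simp only [map_inv₀, Complex.conj_ofReal]
      field_simp
    · simp
  -- Multiplication by z or w takes a monomial to the next one, and the ratio of the two norms is
  -- the weight.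
  have hstep : ∀ {u : Ω → ℂ} (hu : MemLp u ⊤ P) (k l : ℕ × ℕ) (c : ℝ), 0 < c →
      moment α β l = c ^ 2 * moment α β k →
      (∀ x, u x * (z x ^ k.1 * w x ^ k.2) = z x ^ l.1 * w x ^ l.2) →
      mulOp hu (v k) = (c : ℂ) • v l := by
    intro u hu k l c hc hm hmul
    have h1 : mulOp hu (hmem k).toLp = (hmem l).toLp := by
      refine Lp.ext ?_
      filter_upwards [coeFn_mulOp hu (hmem k).toLp, (hmem k).coeFn_toLp,
        (hmem l).coeFn_toLp] with x h1 h2 h3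
      rw [h1, h2, h3, hmul]
    simp only [v, map_smul, h1, smul_smul]
    congr 1
    rw [hm, Real.sqrt_mul (by positivity), Real.sqrt_sq hc.le]
    have : (c : ℂ) ≠ 0 := by exact_mod_cast hc.ne'
    push_cast
    rw [mul_inv, mul_inv_cancel_left₀ this]
  have hV := isometryOfOrthonormal_basisVec hv
  refine ⟨Lp ℂ 2 P, inferInstance, inferInstance, inferInstance, isometryOfOrthonormal hv,
    mulOp hz, mulOp hw, isStarNormal_mulOp hz, isStarNormal_mulOp hw, commute_mulOp hz hw, ?_, ?_⟩
  · intro x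
    have : mulOp hz ∘L (isometryOfOrthonormal hv).toContinuousLinearMap
        = (isometryOfOrthonormal hv).toContinuousLinearMap ∘L shiftOne α := by
      refine ext_basisVec fun ⟨i, j⟩ => ?_
      simp only [ContinuousLinearMap.comp_apply, LinearIsometry.coe_toContinuousLinearMap, hV,
        shiftOne_basisVec, map_smul]
      exact hstep hz _ _ _ (α.pos _) (moment_east hT i j) fun x => by ring
    exact congrArg (fun F => F x) this
  · intro x
    have : mulOp hw ∘L (isometryOfOrthonormal hv).toContinuousLinearMap
        = (isometryOfOrthonormal hv).toContinuousLinearMap ∘L shiftTwo β := by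
      refine ext_basisVec fun ⟨i, j⟩ => ?_
      simp only [ContinuousLinearMap.comp_apply, LinearIsometry.coe_toContinuousLinearMap, hV,
        shiftTwo_basisVec, map_smul]
      exact hstep hw _ _ _ (β.pos _) (moment_north α β i j) fun x => by ring
    exact congrArg (fun F => F x) this

theorem integral_star_fourier_mul_fourier (k l : ℕ) :
    ∫ θ : AddCircle (1 : ℝ), star (fourier (k : ℤ) θ) * fourier (l : ℤ) θ
      ∂AddCircle.haarAddCircle = if k = l then (1 : ℂ) else 0 := by
  have h := (orthonormal_iff_ite.1 (orthonormal_fourier (T := (1 : ℝ)))) k l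
  rw [fourierLp, fourierLp, ContinuousMap.inner_toLp] at h
  simp only [Nat.cast_inj] at h
  rw [← h]
  exact integral_congr_ae (Filter.Eventually.of_forall fun θ => mul_comm _ _)

/-- A pair of commuting weighted shifts with a compactly supported representing measure on the
quadrant is subnormal. -/
theorem isSubnormalPair_of_moments {α β : Weights (ℕ × ℕ)}
    (hT : Commute (shiftOne α) (shiftTwo β)) (μ : ProbabilityMeasure (ℝ × ℝ)) {M N : ℝ}
    (hsupp : (μ : Measure (ℝ × ℝ)) (Set.Icc 0 M ×ˢ Set.Icc 0 N)ᶜ = 0)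
    (hmom : ∀ k : ℕ × ℕ, ∫ p, p.1 ^ k.1 * p.2 ^ k.2 ∂(μ : Measure (ℝ × ℝ)) = moment α β k) :
    IsSubnormalPair (shiftOne α) (shiftTwo β) := by
  let h : Measure (AddCircle (1 : ℝ)) := AddCircle.haarAddCircle
  -- Independent uniform phases on √s and √t make distinct monomials orthogonal, while the squared
  -- moduli remain s and t.
  let P : Measure ((ℝ × ℝ) × (AddCircle (1 : ℝ) × AddCircle (1 : ℝ))) :=
    (μ : Measure (ℝ × ℝ)).prod (h.prod h)
  let f : C(AddCircle (1 : ℝ), ℂ) := fourier 1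
  have hf : ∀ (n : ℕ) θ, f θ ^ n = fourier (n : ℤ) θ := by
    intro n θ
    simp only [f, fourier_apply, one_smul, AddCircle.toCircle_zsmul]
    simp
  have hf1 : ∀ θ, ‖f θ‖ = 1 := fun θ => by
    simp only [f, fourier_apply, Circle.norm_coe]
  have hae : ∀ᵐ x ∂P, (0 ≤ x.1.1 ∧ x.1.1 ≤ M) ∧ (0 ≤ x.1.2 ∧ x.1.2 ≤ N) := by
    have h0 : ∀ᵐ p ∂(μ : Measure (ℝ × ℝ)), (0 ≤ p.1 ∧ p.1 ≤ M) ∧ (0 ≤ p.2 ∧ p.2 ≤ N) := hsupp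
    exact Measure.quasiMeasurePreserving_fst.ae h0
  have hz : MemLp (fun x : (ℝ × ℝ) × (AddCircle (1 : ℝ) × AddCircle (1 : ℝ)) =>
      (√x.1.1 : ℂ) * f x.2.1) ⊤ P := by
    refine memLp_top_of_bound (C := √M) (Continuous.aestronglyMeasurable (by fun_prop)) ?_
    filter_upwards [hae] with x hx
    rw [norm_mul, hf1, mul_one, Complex.norm_real, Real.norm_of_nonneg (Real.sqrt_nonneg _)]
    exact Real.sqrt_le_sqrt hx.1.2
  have hw : MemLp (fun x : (ℝ × ℝ) × (AddCircle (1 : ℝ) × AddCircle (1 : ℝ)) =>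
      (√x.1.2 : ℂ) * f x.2.2) ⊤ P := by
    refine memLp_top_of_bound (C := √N) (Continuous.aestronglyMeasurable (by fun_prop)) ?_
    filter_upwards [hae] with x hx
    rw [norm_mul, hf1, mul_one, Complex.norm_real, Real.norm_of_nonneg (Real.sqrt_nonneg _)]
    exact Real.sqrt_le_sqrt hx.2.2
  refine isSubnormalPair_of_orthogonal_monomials hT hz hw fun k l => ?_
  have hsplit : ∀ x : (ℝ × ℝ) × (AddCircle (1 : ℝ) × AddCircle (1 : ℝ)),
      star (((√x.1.1 : ℂ) * f x.2.1) ^ k.1 * ((√x.1.2 : ℂ) * f x.2.2) ^ k.2) *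
        (((√x.1.1 : ℂ) * f x.2.1) ^ l.1 * ((√x.1.2 : ℂ) * f x.2.2) ^ l.2)
      = ((√x.1.1 ^ (k.1 + l.1) * √x.1.2 ^ (k.2 + l.2) : ℝ) : ℂ) *
        ((star (fourier (k.1 : ℤ) x.2.1) * fourier (l.1 : ℤ) x.2.1) *
          (star (fourier (k.2 : ℤ) x.2.2) * fourier (l.2 : ℤ) x.2.2)) := by
    intro x
    simp only [mul_pow, hf, star_mul', star_pow, RCLike.star_def, Complex.conj_ofReal]
    push_cast
    ring
  simp only [hsplit]
  have h1 := integral_prod_mul (μ := (μ : Measure (ℝ × ℝ))) (ν := h.prod h)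
    (fun p : ℝ × ℝ => ((√p.1 ^ (k.1 + l.1) * √p.2 ^ (k.2 + l.2) : ℝ) : ℂ))
    (fun q : AddCircle (1 : ℝ) × AddCircle (1 : ℝ) =>
      (star (fourier (k.1 : ℤ) q.1) * fourier (l.1 : ℤ) q.1) *
          (star (fourier (k.2 : ℤ) q.2) * fourier (l.2 : ℤ) q.2))
  have h2 := integral_prod_mul (μ := h) (ν := h)
    (fun q : AddCircle (1 : ℝ) => star (fourier (k.1 : ℤ) q) * fourier (l.1 : ℤ) q)
    (fun q : AddCircle (1 : ℝ) => star (fourier (k.2 : ℤ) q) * fourier (l.2 : ℤ) q)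
  rw [h1, h2, integral_star_fourier_mul_fourier, integral_star_fourier_mul_fourier]
  by_cases hkl : k = l
  · subst hkl
    simp only [if_true, mul_one]
    rw [← hmom]
    refine (integral_ofReal (f := fun p : ℝ × ℝ =>
      √p.1 ^ (k.1 + k.1) * √p.2 ^ (k.2 + k.2))).trans (congrArg _ (integral_congr_ae ?_))
    filter_upwards [show ∀ᵐ p ∂(μ : Measure (ℝ × ℝ)),
      (0 ≤ p.1 ∧ p.1 ≤ M) ∧ (0 ≤ p.2 ∧ p.2 ≤ N) from hsupp] with p hp
    rw [← two_mul, ← two_mul, pow_mul, pow_mul, Real.sq_sqrt hp.1.1, Real.sq_sqrt hp.2.1]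
  · rw [if_neg hkl]
    have : ¬ (k.1 = l.1 ∧ k.2 = l.2) := fun h => hkl (Prod.ext h.1 h.2)
    by_cases hk : k.1 = l.1
    · simp [show k.2 ≠ l.2 from fun h => this ⟨hk, h⟩]
    · simp [hk]

/-! ### Polynomials peaking at a point -/

theorem ae_mem_of_compl_eq_zero {ν : Measure ℝ} {M : ℝ} (h : ν (Set.Icc 0 M)ᶜ = 0) :
    ∀ᵐ t ∂ν, t ∈ Set.Icc 0 M := h

theorem integrable_of_continuous_of_support {ν : Measure ℝ} [IsFiniteMeasure ν] {M : ℝ}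
    (h : ν (Set.Icc 0 M)ᶜ = 0) {f : ℝ → ℝ} (hf : Continuous f) : Integrable f ν := by
  obtain ⟨C, hC⟩ := (isCompact_Icc (a := (0 : ℝ)) (b := M)).exists_bound_of_continuousOn
    hf.continuousOn
  exact Integrable.of_bound hf.aestronglyMeasurable C
    ((ae_mem_of_compl_eq_zero h).mono fun t ht => hC t ht)

theorem integrable_eval {ν : Measure ℝ} [IsFiniteMeasure ν] {M : ℝ}
    (h : ν (Set.Icc 0 M)ᶜ = 0) (p : Polynomial ℝ) : Integrable (fun t => p.eval t) ν :=
  integrable_of_continuous_of_support h p.continuous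

/-- A polynomial with value `1` at `x` can be sharpened to peak at `x` on the support of `ν`. -/
theorem exists_peak_polynomials (ν : Measure ℝ) [IsFiniteMeasure ν] {M : ℝ}
    (h : ν (Set.Icc 0 M)ᶜ = 0) (x : ℝ) (hx : 0 ≤ x) (p : Polynomial ℝ) (hp : p.eval x = 1) :
    ∃ f : ℕ → Polynomial ℝ, (∀ n, (f n).eval x = 1) ∧
      (∀ n y, p.eval y = 0 → (f n).eval y = 0) ∧
      Filter.Tendsto (fun n => ∫ t, (f n ^ 2).eval t ∂ν) Filter.atTop (nhds (ν.real {x})) := by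
  -- L exceeds |t - x| on [0, M], so q takes values in [0, 1] there and equals 1 only at x. Hence (p
  -- qⁿ)² tends to the indicator of {x}, while p keeps its zeros.
  let L := |M| + x + 1
  have hL : 0 < L := by positivity
  let q : Polynomial ℝ := 1 - Polynomial.C (1 / L ^ 2) * (Polynomial.X - Polynomial.C x) ^ 2
  have hq : ∀ t, q.eval t = 1 - (t - x) ^ 2 / L ^ 2 := fun t => by simp [q]; ring
  have hlt : ∀ t ∈ Set.Icc 0 M, (t - x) ^ 2 < L ^ 2 := by
    intro t ht
    have := le_abs_self M
    refine sq_lt_sq' ?_ ?_ <;> simp only [L] <;> linarith [ht.1, ht.2, abs_nonneg M]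
  have hq0 : ∀ t ∈ Set.Icc 0 M, 0 ≤ q.eval t := by
    intro t ht
    rw [hq, sub_nonneg, div_le_one (by positivity)]
    exact (hlt t ht).le
  have hq1 : ∀ t, q.eval t ≤ 1 := by
    intro t
    rw [hq, sub_le_self_iff]
    positivity
  refine ⟨fun n => p * q ^ n, fun n => by simp [hp, hq], fun n y hy => by simp [hy], ?_⟩
  have hlim : ∫ t, Set.indicator {x} (fun _ => (1 : ℝ)) t ∂ν = ν.real {x} := by
    rw [integral_indicator (measurableSet_singleton x)]
    simp [Measure.real]
  rw [← hlim]
  obtain ⟨C, hC⟩ := (isCompact_Icc (a := (0 : ℝ)) (b := M)).exists_bound_of_continuousOn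
    (p ^ 2).continuous.continuousOn
  refine tendsto_integral_of_dominated_convergence (fun _ => C)
    (fun n => (Polynomial.continuous _).aestronglyMeasurable) (integrable_const _) (fun n => ?_) ?_
  · filter_upwards [ae_mem_of_compl_eq_zero h] with t ht
    have h1 := hC t ht
    have h2 : q.eval t ^ (2 * n) ≤ 1 := pow_le_one₀ (hq0 t ht) (hq1 t)
    have h3 : 0 ≤ q.eval t ^ (2 * n) := pow_nonneg (hq0 t ht) _
    have h4 : ((p * q ^ n) ^ 2).eval t = (p ^ 2).eval t * q.eval t ^ (2 * n) := by
      simp only [Polynomial.eval_pow, Polynomial.eval_mul]; ring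
    rw [h4, norm_mul, Real.norm_of_nonneg h3]
    exact (mul_le_of_le_one_right (norm_nonneg _) h2).trans h1
  · filter_upwards [ae_mem_of_compl_eq_zero h] with t ht
    by_cases htx : t = x
    · subst htx
      simp [hp, hq]
    · rw [Set.indicator_of_notMem (by simpa using htx)]
      have h2 : q.eval t < 1 := by
        rw [hq, sub_lt_self_iff]
        have := sub_ne_zero.2 htx
        positivity
      have h4 : ∀ n, ((p * q ^ n) ^ 2).eval t = (p ^ 2).eval t * (q.eval t ^ 2) ^ n := by
        intro n; simp only [Polynomial.eval_pow, Polynomial.eval_mul]; ring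
      simp only [h4]
      rw [← mul_zero ((p ^ 2).eval t)]
      refine Filter.Tendsto.const_mul _ (tendsto_pow_atTop_nhds_zero_of_lt_one (sq_nonneg _) ?_)
      exact pow_lt_one₀ (hq0 t ht) h2 two_ne_zero

/-! ### Positivity of the moment functional and the necessary conditions -/

/-- The operator `p(A)` for a real polynomial `p`. -/
def realAeval {K : Type} [NormedAddCommGroup K] [InnerProductSpace ℂ K] (A : K →L[ℂ] K)
    (p : Polynomial ℝ) : K →L[ℂ] K :=
  Polynomial.aeval A (p.map (algebraMap ℝ ℂ))

theorem isSelfAdjoint_realAeval {K : Type} [NormedAddCommGroup K] [InnerProductSpace ℂ K]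
    [CompleteSpace K] {A : K →L[ℂ] K} (hA : IsSelfAdjoint A) (p : Polynomial ℝ) :
    IsSelfAdjoint (realAeval A p) := by
  induction p using Polynomial.induction_on' with
  | add p q hp hq => simpa [realAeval] using hp.add hq
  | monomial n a =>
    simp only [realAeval, Polynomial.map_monomial, Polynomial.aeval_monomial]
    rw [← Algebra.smul_def]
    refine IsSelfAdjoint.smul ?_ (hA.pow n)
    simp [IsSelfAdjoint]

theorem commute_realAeval {K : Type} [NormedAddCommGroup K] [InnerProductSpace ℂ K]
    {A B : K →L[ℂ] K} (h : Commute A B) (p q : Polynomial ℝ) :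
    Commute (realAeval A p) (realAeval B q) := by
  have : ∀ (C D : K →L[ℂ] K) (r : Polynomial ℂ), Commute C D →
      Commute (Polynomial.aeval C r) D := by
    intro C D r hCD
    induction r using Polynomial.induction_on' with
    | add p q hp hq => simpa using hp.add_left hq
    | monomial n a =>
      rw [Polynomial.aeval_monomial]
      exact Commute.mul_left (Algebra.commutes a D) (hCD.pow_left n)
  exact this _ _ _ (this _ _ _ h.symm).symm

/-- Moment functional of a pair of commuting self-adjoint operators in a vector state, for the
moments of a flat 2-variable weighted shift. -/
theorem inner_realAeval {K : Type} [NormedAddCommGroup K] [InnerProductSpace ℂ K]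
    {A B : K →L[ℂ] K} {v : K} {ξ η : Measure ℝ} [IsProbabilityMeasure ξ]
    [IsProbabilityMeasure η] {M N c d : ℝ} (hξ : ξ (Set.Icc 0 M)ᶜ = 0)
    (hη : η (Set.Icc 0 N)ᶜ = 0)
    (hrow : ∀ i : ℕ, inner ℂ v ((A ^ i) v) = ((∫ s, s ^ i ∂ξ : ℝ) : ℂ))
    (hcol : ∀ j : ℕ, inner ℂ v ((B ^ j) v) = ((∫ t, t ^ j ∂η : ℝ) : ℂ))
    (hcore : ∀ i j : ℕ, inner ℂ v ((A ^ (i + 1) * B ^ (j + 1)) v) = ((c * d ^ (j + 1) : ℝ) : ℂ))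
    (F G : Polynomial ℝ) :
    inner ℂ v ((realAeval A F * realAeval B G) v)
      = ((G.eval 0 * ∫ s, F.eval s ∂ξ + F.eval 0 * ∫ t, G.eval t ∂η - F.eval 0 * G.eval 0
        + c * (F.eval 1 - F.eval 0) * (G.eval d - G.eval 0) : ℝ) : ℂ) := by
  have hadd : ∀ (A : K →L[ℂ] K) (p q : Polynomial ℝ),
      realAeval A (p + q) = realAeval A p + realAeval A q := fun A p q => by simp [realAeval]
  have hmon : ∀ (A : K →L[ℂ] K) (n : ℕ) (a : ℝ),
      realAeval A (Polynomial.monomial n a) = (a : ℂ) • A ^ n := fun A n a => by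
    simp [realAeval, Polynomial.aeval_monomial, ← Algebra.smul_def]
  -- Both sides are bilinear in (F, G), so monomials suffice. The term -F(0) G(0) corrects the
  -- constant term, which both marginal integrals count.
  induction F using Polynomial.induction_on' with
  | add p q hp hq =>
    rw [hadd, add_mul, add_apply, inner_add_right, hp, hq, ← Complex.ofReal_add]
    congr 1
    simp only [Polynomial.eval_add]
    rw [integral_add (integrable_eval hξ p) (integrable_eval hξ q)]
    ring
  | monomial i a =>
    induction G using Polynomial.induction_on' with
    | add p q hp hq =>
      rw [hadd, mul_add, add_apply, inner_add_right, hp, hq, ← Complex.ofReal_add]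
      congr 1
      simp only [Polynomial.eval_add]
      rw [integral_add (integrable_eval hη p) (integrable_eval hη q)]
      ring
    | monomial j b =>
      rw [hmon, hmon, smul_mul_smul_comm, smul_apply, inner_smul_right]
      simp only [Polynomial.eval_monomial, integral_const_mul]
      rcases i with _ | i
      · rw [pow_zero, one_mul, hcol, ← Complex.ofReal_mul, ← Complex.ofReal_mul]
        congr 1
        simp
        ring
      · rcases j with _ | j
        · rw [pow_zero, mul_one, hrow, ← Complex.ofReal_mul, ← Complex.ofReal_mul]
          congr 1
          simp
          ring
        · rw [hcore, ← Complex.ofReal_mul, ← Complex.ofReal_mul]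
          congr 1
          simp
          ring

/-- By commutation and self-adjointness the inner product is ‖f(A) g(B) v‖². -/
theorem moment_functional_sq_nonneg {K : Type} [NormedAddCommGroup K] [InnerProductSpace ℂ K]
    [CompleteSpace K] {A B : K →L[ℂ] K} (hA : IsSelfAdjoint A) (hB : IsSelfAdjoint B)
    (hAB : Commute A B) (v : K) (f g : Polynomial ℝ) :
    0 ≤ (inner ℂ v ((realAeval A (f ^ 2) * realAeval B (g ^ 2)) v)).re := by
  have hpow : ∀ (A : K →L[ℂ] K) (p : Polynomial ℝ),
      realAeval A (p ^ 2) = realAeval A p * realAeval A p := fun A p => by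
    simp [realAeval, sq]
  have h1 : realAeval A (f ^ 2) * realAeval B (g ^ 2)
      = star (realAeval A f * realAeval B g) * (realAeval A f * realAeval B g) := by
    rw [star_mul, (isSelfAdjoint_realAeval hA f).star_eq, (isSelfAdjoint_realAeval hB g).star_eq,
      hpow, hpow]
    have hc := (commute_realAeval hAB f g).eq
    calc _ = realAeval A f * (realAeval A f * realAeval B g) * realAeval B g := by
          simp only [mul_assoc]
      _ = realAeval A f * realAeval B g * (realAeval A f * realAeval B g) := by
          nth_rw 1 [hc]; simp only [mul_assoc]
      _ = _ := by nth_rw 1 [hc]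
  rw [h1, mul_apply_eq_comp, ContinuousLinearMap.star_eq_adjoint,
    ContinuousLinearMap.adjoint_inner_right]
  exact inner_self_nonneg (𝕜 := ℂ)

theorem shiftOne_pow_basisVec {α : Weights (ℕ × ℕ)} (i j : ℕ) :
    ((shiftOne α) ^ i) (basisVec (0, j))
      = ((∏ n ∈ Finset.range i, α (n, j) : ℝ) : ℂ) • basisVec (i, j) := by
  induction i with
  | zero => simp
  | succ i ih =>
    rw [pow_succ', mul_apply_eq_comp, ih, map_smul, shiftOne_basisVec,
      smul_smul, Finset.prod_range_succ, Complex.ofReal_mul]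

theorem shiftTwo_pow_basisVec {β : Weights (ℕ × ℕ)} (i j : ℕ) :
    ((shiftTwo β) ^ j) (basisVec (i, 0))
      = ((∏ n ∈ Finset.range j, β (i, n) : ℝ) : ℂ) • basisVec (i, j) := by
  induction j with
  | zero => simp
  | succ j ih =>
    rw [pow_succ', mul_apply_eq_comp, ih, map_smul, shiftTwo_basisVec,
      smul_smul, Finset.prod_range_succ, Complex.ofReal_mul]

theorem norm_sq_shift_pow (α β : Weights (ℕ × ℕ)) (i j : ℕ) :
    ‖((shiftTwo β) ^ j) (((shiftOne α) ^ i) (basisVec (0, 0)))‖ ^ 2 = moment α β (i, j) := by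
  rw [shiftOne_pow_basisVec, map_smul, shiftTwo_pow_basisVec, norm_smul, norm_smul,
    norm_basisVec, mul_one, mul_pow, Complex.norm_real, Complex.norm_real, Real.norm_eq_abs,
    Real.norm_eq_abs, sq_abs, sq_abs, moment, Finset.prod_pow, Finset.prod_pow]

/-- For commuting normal operators, `⟨(N₁*N₁)^i (N₂*N₂)^j v, v⟩ = ‖N₂^j N₁^i v‖²`. -/
theorem inner_pow_mul_pow {K : Type} [NormedAddCommGroup K] [InnerProductSpace ℂ K]
    [CompleteSpace K] {N₁ N₂ : K →L[ℂ] K} (h₁ : IsStarNormal N₁) (h₂ : IsStarNormal N₂)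
    (h : Commute N₁ N₂) (v : K) (i j : ℕ) :
    inner ℂ v (((star N₁ * N₁) ^ i * (star N₂ * N₂) ^ j) v)
      = ((‖(N₂ ^ j) ((N₁ ^ i) v)‖ ^ 2 : ℝ) : ℂ) := by
  -- Fuglede's theorem.
  have hs : Commute N₁ (star N₂) := h₂.commute_star_right h
  have h1 : (star N₁ * N₁) ^ i * (star N₂ * N₂) ^ j
      = star (N₂ ^ j * N₁ ^ i) * (N₂ ^ j * N₁ ^ i) := by
    rw [h₁.star_comm_self.mul_pow, h₂.star_comm_self.mul_pow, star_mul, star_pow, star_pow]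
    have e1 := (hs.pow_pow i j).eq
    have e2 := (h.pow_pow i j).eq
    calc _ = star N₁ ^ i * (N₁ ^ i * star N₂ ^ j) * N₂ ^ j := by simp only [mul_assoc]
      _ = star N₁ ^ i * star N₂ ^ j * (N₁ ^ i * N₂ ^ j) := by rw [e1]; simp only [mul_assoc]
      _ = _ := by rw [e2]
  rw [h1, mul_apply_eq_comp, ContinuousLinearMap.star_eq_adjoint,
    ContinuousLinearMap.adjoint_inner_right, inner_self_eq_norm_sq_to_K]
  simp [mul_apply_eq_comp]

theorem map_pow_of_intertwines {H K : Type} [NormedAddCommGroup H] [InnerProductSpace ℂ H]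
    [NormedAddCommGroup K] [InnerProductSpace ℂ K] {V : H →ₗᵢ[ℂ] K} {N : K →L[ℂ] K}
    {T : H →L[ℂ] H} (h : ∀ x, N (V x) = V (T x)) (i : ℕ) (x : H) :
    (N ^ i) (V x) = V ((T ^ i) x) := by
  induction i with
  | zero => simp
  | succ i ih =>
    rw [pow_succ', pow_succ', mul_apply_eq_comp,
      mul_apply_eq_comp, ih, h]

/-- Necessary conditions for subnormality of a flat pair, on the atoms of the marginals. -/
theorem atoms_of_isSubnormalPair {α β : Weights (ℕ × ℕ)} {ξ η : Measure ℝ}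
    [IsProbabilityMeasure ξ] [IsProbabilityMeasure η] {M N c d : ℝ}
    (hξ : ξ (Set.Icc 0 M)ᶜ = 0) (hη : η (Set.Icc 0 N)ᶜ = 0) (hd : 0 < d)
    (hrow : ∀ i : ℕ, ∫ s, s ^ i ∂ξ = moment α β (i, 0))
    (hcol : ∀ j : ℕ, ∫ t, t ^ j ∂η = moment α β (0, j))
    (hcore : ∀ i j : ℕ, moment α β (i + 1, j + 1) = c * d ^ (j + 1))
    (hsub : IsSubnormalPair (shiftOne α) (shiftTwo β)) :
    c ≤ η.real {d} ∧ c ≤ ξ.real {1} ∧ 1 - c ≤ ξ.real {0} + η.real {0} := by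
  obtain ⟨K, _, _, _, V, N₁, N₂, hN₁, hN₂, hN, hV₁, hV₂⟩ := hsub
  have hs : Commute N₁ (star N₂) := hN₂.commute_star_right hN
  have hs' : Commute (star N₁) N₂ := hN₁.commute_star_left hN
  have hss : Commute (star N₁) (star N₂) := hN.star_star
  have hAB : Commute (star N₁ * N₁) (star N₂ * N₂) :=
    (hss.mul_right hs').mul_left (hs.mul_right hN)
  have hmom : ∀ i j : ℕ, inner ℂ (V (basisVec (0, 0)))
      (((star N₁ * N₁) ^ i * (star N₂ * N₂) ^ j) (V (basisVec (0, 0))))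
        = ((moment α β (i, j) : ℝ) : ℂ) := by
    intro i j
    rw [inner_pow_mul_pow hN₁ hN₂ hN, map_pow_of_intertwines hV₁, map_pow_of_intertwines hV₂,
      LinearIsometry.norm_map, norm_sq_shift_pow]
  have key : ∀ f g : Polynomial ℝ, 0 ≤ (g ^ 2).eval 0 * ∫ s, (f ^ 2).eval s ∂ξ
      + (f ^ 2).eval 0 * ∫ t, (g ^ 2).eval t ∂η - (f ^ 2).eval 0 * (g ^ 2).eval 0
        + c * ((f ^ 2).eval 1 - (f ^ 2).eval 0) * ((g ^ 2).eval d - (g ^ 2).eval 0) := by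
    intro f g
    have h := moment_functional_sq_nonneg (IsSelfAdjoint.star_mul_self N₁)
      (IsSelfAdjoint.star_mul_self N₂) hAB (V (basisVec (0, 0))) f g
    rwa [inner_realAeval hξ hη (fun i => by simpa [hrow] using hmom i 0)
      (fun j => by simpa [hcol] using hmom 0 j)
      (fun i j => by rw [hmom, hcore]) (f ^ 2) (g ^ 2), Complex.ofReal_re] at h
  obtain ⟨gd, gd1, gd0, gdlim⟩ := exists_peak_polynomials η hη d hd.le
    (Polynomial.C (1 / d) * Polynomial.X) (by simp [hd.ne'])
  obtain ⟨f1, f11, f10, f1lim⟩ := exists_peak_polynomials ξ hξ 1 zero_le_one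
    Polynomial.X (by simp)
  obtain ⟨f0, f01, f00, f0lim⟩ := exists_peak_polynomials ξ hξ 0 le_rfl
    (1 - Polynomial.X) (by simp)
  obtain ⟨g0, g01, g00, g0lim⟩ := exists_peak_polynomials η hη 0 le_rfl
    (1 - Polynomial.C (1 / d) * Polynomial.X) (by simp)
  refine ⟨?_, ?_, ?_⟩
  -- f is 1 at 0 and 0 at 1, g is 0 at 0 and 1 at d: positivity reads c ≤ ∫ g² dη, and g² peaks at
  -- d.
  · refine ge_of_tendsto' gdlim fun n => ?_
    have h := key (1 - Polynomial.X) (gd n)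
    simp only [Polynomial.eval_pow, gd1, gd0 n 0 (by simp)] at h ⊢
    simp at h
    linarith
  -- The same with the two variables exchanged.
  · refine ge_of_tendsto' f1lim fun n => ?_
    have h := key (f1 n) (1 - Polynomial.C (1 / d) * Polynomial.X)
    simp only [Polynomial.eval_pow, f11, f10 n 0 (by simp)] at h ⊢
    simp [hd.ne'] at h
    linarith
  -- Both polynomials peak at 0, f vanishing at 1 and g at d: positivity reads 1 - c ≤ ∫ f² dξ + ∫
  -- g² dη.
  · refine ge_of_tendsto' (f0lim.add g0lim) fun n => ?_
    have h := key (f0 n) (g0 n)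
    simp only [Polynomial.eval_pow, f01, g01, f00 n 1 (by simp),
      g00 n d (by simp [hd.ne'])] at h ⊢
    simp at h
    linarith

/-! ### Determinacy of compactly supported measures -/

/-- Two finite measures on the plane with a common compact support and the same moments agree. -/
theorem eq_of_forall_moment_eq {μ ν : Measure (ℝ × ℝ)} [IsFiniteMeasure μ] [IsFiniteMeasure ν]
    {S : Set (ℝ × ℝ)} (hS : IsCompact S) (hμ : μ Sᶜ = 0) (hν : ν Sᶜ = 0)
    (h : ∀ i j : ℕ, ∫ p, p.1 ^ i * p.2 ^ j ∂μ = ∫ p, p.1 ^ i * p.2 ^ j ∂ν) : μ = ν := by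
  have hint : ∀ (ρ : Measure (ℝ × ℝ)) [IsFiniteMeasure ρ] (_ : ρ Sᶜ = 0) (f : C(ℝ × ℝ, ℝ)),
      Integrable f ρ := by
    intro ρ _ hρ f
    obtain ⟨C, hC⟩ := hS.exists_bound_of_continuousOn f.continuous.continuousOn
    exact Integrable.of_bound f.continuous.aestronglyMeasurable C
      ((show ∀ᵐ p ∂ρ, p ∈ S from hρ).mono fun t ht => hC t ht)
  let X : C(ℝ × ℝ, ℝ) := ⟨Prod.fst, continuous_fst⟩
  let Y : C(ℝ × ℝ, ℝ) := ⟨Prod.snd, continuous_snd⟩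
  let A : Subalgebra ℝ C(ℝ × ℝ, ℝ) := Algebra.adjoin ℝ {X, Y}
  have hsep : A.SeparatesPoints := by
    intro p q hpq
    by_cases h1 : p.1 = q.1
    · exact ⟨_, ⟨Y, Algebra.subset_adjoin (by simp), rfl⟩, fun h2 => hpq (Prod.ext h1 h2)⟩
    · exact ⟨_, ⟨X, Algebra.subset_adjoin (by simp), rfl⟩, h1⟩
  have hA : ∀ g ∈ A, ∫ p, g p ∂μ = ∫ p, g p ∂ν := by
    intro g hg
    rw [← Subalgebra.mem_toSubmodule, Algebra.adjoin_eq_span] at hg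
    induction hg using Submodule.span_induction with
    | mem g hg =>
      obtain ⟨i, j, rfl⟩ := (Submonoid.mem_closure_pair _ _ _).1 hg
      exact h i j
    | zero => simp
    | add f g _ _ hf hg =>
      simp only [ContinuousMap.add_apply]
      rw [integral_add (hint μ hμ f) (hint μ hμ g), integral_add (hint ν hν f) (hint ν hν g),
        hf, hg]
    | smul r f _ hf =>
      simp only [ContinuousMap.smul_apply, integral_smul, hf]
  refine ext_of_forall_integral_eq_of_IsFiniteMeasure fun f => ?_
  refine eq_of_forall_dist_le fun ε hε => ?_
  -- A polynomial within ε / C of f on S changes the two integrals by at most ε in total; the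
  -- summand 1 keeps C positive.
  let C := μ.real Set.univ + ν.real Set.univ + 1
  have hC : 0 < C := by positivity
  obtain ⟨g, hgA, hg⟩ :=
    ContinuousMap.exists_mem_subalgebra_near_continuous_of_isCompact_of_separatesPoints hsep
      f.toContinuousMap hS (div_pos hε hC)
  have hclose : ∀ (ρ : Measure (ℝ × ℝ)) [IsFiniteMeasure ρ] (_ : ρ Sᶜ = 0),
      |∫ p, g p ∂ρ - ∫ p, f p ∂ρ| ≤ ε / C * ρ.real Set.univ := by
    intro ρ _ hρ
    have hf : Integrable f ρ := hint ρ hρ f.toContinuousMap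
    rw [← integral_sub (hint ρ hρ g) hf]
    refine norm_integral_le_of_norm_le_const (μ := ρ) (f := fun p => g p - f p) ?_
    filter_upwards [show ∀ᵐ p ∂ρ, p ∈ S from hρ] with p hp
    exact (hg p hp).le
  have h1 := hclose μ hμ
  have h2 := hclose ν hν
  rw [hA g hgA] at h1
  have h3 : ε / C * μ.real Set.univ + ε / C * ν.real Set.univ ≤ ε := by
    rw [← mul_add, div_mul_eq_mul_div, div_le_iff₀ hC]
    exact mul_le_mul_of_nonneg_left (by simp [C]) hε.le
  rw [Real.dist_eq]
  rw [abs_le] at h1 h2 ⊢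
  constructor <;> linarith [h1.1, h1.2, h2.1, h2.2]

/-- Reduction to the plane along t ↦ (t, 0). -/
theorem eq_of_forall_moment_eq_real {μ ν : Measure ℝ} [IsFiniteMeasure μ] [IsFiniteMeasure ν]
    {M N : ℝ} (hμ : μ (Set.Icc 0 M)ᶜ = 0) (hν : ν (Set.Icc 0 N)ᶜ = 0)
    (h : ∀ i : ℕ, ∫ t, t ^ i ∂μ = ∫ t, t ^ i ∂ν) : μ = ν := by
  have hm : Measurable fun t : ℝ => (t, (0 : ℝ)) := measurable_id.prodMk measurable_const
  have hS : ∀ (ρ : Measure ℝ) (L : ℝ), L ≤ max M N → ρ (Set.Icc 0 L)ᶜ = 0 →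
      ρ.map (fun t : ℝ => (t, (0 : ℝ))) (Set.Icc 0 (max M N) ×ˢ {0})ᶜ = 0 := by
    intro ρ L hL hρ
    rw [Measure.map_apply hm (measurableSet_Icc.prod (measurableSet_singleton _)).compl]
    refine measure_mono_null (fun t ht => ?_) hρ
    contrapose! ht
    simp only [Set.mem_compl_iff, not_not] at ht
    exact fun h => h ⟨⟨ht.1, ht.2.trans hL⟩, rfl⟩
  have key : μ.map (fun t : ℝ => (t, (0 : ℝ))) = ν.map (fun t : ℝ => (t, (0 : ℝ))) := by
    refine eq_of_forall_moment_eq (isCompact_Icc.prod isCompact_singleton)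
      (hS μ M (le_max_left _ _) hμ) (hS ν N (le_max_right _ _) hν) fun i j => ?_
    have hc : Continuous fun p : ℝ × ℝ => p.1 ^ i * p.2 ^ j := by fun_prop
    rw [integral_map hm.aemeasurable hc.aestronglyMeasurable,
      integral_map hm.aemeasurable hc.aestronglyMeasurable]
    dsimp only
    rw [integral_mul_const, integral_mul_const, h]
  have := congrArg (Measure.map Prod.fst) key
  rwa [Measure.map_map measurable_fst hm, Measure.map_map measurable_fst hm,
    show (Prod.fst ∘ fun t : ℝ => (t, (0 : ℝ))) = id from rfl, Measure.map_id,
    Measure.map_id] at this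

/-! ### Splitting off atoms, and the density t / r -/

/-- A point mass not exceeding an atom of a finite measure can be split off. -/
theorem exists_add_dirac_eq (ρ : Measure ℝ) [IsFiniteMeasure ρ] {x c : ℝ} (hc : 0 ≤ c)
    (h : c ≤ ρ.real {x}) :
    ∃ σ : Measure ℝ, IsFiniteMeasure σ ∧ σ + ENNReal.ofReal c • Measure.dirac x = ρ := by
  refine ⟨ρ.restrict {x}ᶜ + ENNReal.ofReal (ρ.real {x} - c) • Measure.dirac x, ?_, ?_⟩
  · have : IsFiniteMeasure (ENNReal.ofReal (ρ.real {x} - c) • Measure.dirac x) :=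
      Measure.smul_finite _ ENNReal.ofReal_ne_top
    infer_instance
  · rw [add_assoc, ← add_smul, ← ENNReal.ofReal_add (by linarith) hc, sub_add_cancel,
      measureReal_def, ENNReal.ofReal_toReal (measure_ne_top _ _), ← Measure.restrict_singleton,
      add_comm]
    exact Measure.restrict_add_restrict_compl (measurableSet_singleton x)

theorem measureReal_eq_of_add_dirac_eq {σ ρ : Measure ℝ} [IsFiniteMeasure σ] {x c : ℝ}
    (hc : 0 ≤ c) (h : σ + ENNReal.ofReal c • Measure.dirac x = ρ) (B : Set ℝ) :
    ρ.real B = σ.real B + c * (Measure.dirac x).real B := by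
  have : IsFiniteMeasure (ENNReal.ofReal c • Measure.dirac x) :=
    Measure.smul_finite _ ENNReal.ofReal_ne_top
  rw [← h, measureReal_add_apply, measureReal_ennreal_smul_apply,
    ENNReal.toReal_ofReal hc]

theorem integral_eq_of_add_dirac_eq {σ ρ : Measure ℝ} {x c : ℝ}
    (hc : 0 ≤ c) (h : σ + ENNReal.ofReal c • Measure.dirac x = ρ) {f : ℝ → ℝ}
    (hf : Integrable f ρ) : ∫ t, f t ∂ρ = ∫ t, f t ∂σ + c * f x := by
  subst h
  rw [integral_add_measure hf.left_of_add_measure hf.right_of_add_measure, integral_smul_measure,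
    integral_dirac, ENNReal.toReal_ofReal hc, smul_eq_mul]

theorem measure_eq_zero_of_add_eq {σ κ ρ : Measure ℝ} (h : σ + κ = ρ) {B : Set ℝ}
    (hB : ρ B = 0) : σ B = 0 := by
  subst h
  rw [Measure.add_apply] at hB
  exact (add_eq_zero.1 hB).1

/-- The measure with density `t / r`. -/
def timesId (r : ℝ) (σ : Measure ℝ) : Measure ℝ :=
  σ.withDensity fun t => ENNReal.ofReal (t / r)

theorem isFiniteMeasure_timesId (r : ℝ) {σ : Measure ℝ} [IsFiniteMeasure σ] {N : ℝ}
    (h : σ (Set.Icc 0 N)ᶜ = 0) : IsFiniteMeasure (timesId r σ) :=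
  isFiniteMeasure_withDensity_ofReal
    (integrable_of_continuous_of_support h (f := fun t => t / r) (by fun_prop)).2

theorem timesId_add_dirac (r : ℝ) (σ : Measure ℝ) (c x : ℝ) (hc : 0 ≤ c) :
    timesId r (σ + ENNReal.ofReal c • Measure.dirac x)
      = timesId r σ + ENNReal.ofReal (c * x / r) • Measure.dirac x := by
  rw [timesId, withDensity_add_measure, withDensity_smul_measure, timesId]
  congr 1
  have : (Measure.dirac x).withDensity (fun t => ENNReal.ofReal (t / r))
      = ENNReal.ofReal (x / r) • Measure.dirac x := by
    ext s hs
    rw [withDensity_apply _ hs, ← lintegral_indicator hs, lintegral_dirac, Measure.smul_apply,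
      Measure.dirac_apply]
    by_cases hx : x ∈ s <;> simp [hx]
  rw [this, smul_smul, ← ENNReal.ofReal_mul hc, mul_div_assoc]

theorem ae_pos_of_measure_Iic {σ : Measure ℝ} (h : σ (Set.Iic 0) = 0) : ∀ᵐ t ∂σ, 0 < t := by
  rw [ae_iff]
  simpa [Set.Iic] using h

theorem setIntegral_timesId {r : ℝ} (hr : 0 < r) {σ : Measure ℝ} (h : σ (Set.Iic 0) = 0)
    (f : ℝ → ℝ) {s : Set ℝ} (hs : MeasurableSet s) :
    ∫ t in s, f t ∂timesId r σ = ∫ t in s, t / r * f t ∂σ := by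
  rw [timesId, setIntegral_withDensity_eq_setIntegral_toReal_smul (by fun_prop)
    (Filter.Eventually.of_forall fun _ => ENNReal.ofReal_lt_top) _ hs]
  refine integral_congr_ae (ae_restrict_of_ae ?_)
  filter_upwards [ae_pos_of_measure_Iic h] with t ht
  rw [ENNReal.toReal_ofReal (by positivity), smul_eq_mul]

/-! ### The operations `normInv` and `tilde`, and the order on signed measures -/

theorem signed_withDensity_apply {ν : Measure ℝ} [IsFiniteMeasure ν] {f : ℝ → ℝ}
    (hf : Integrable f ν) {s : Set ℝ} (hs : MeasurableSet s) :
    ν.toSignedMeasure.withDensity f (ContinuousLinearMap.mul ℝ ℝ) s = ∫ t in s, f t ∂ν := by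
  have hB : ContinuousLinearMap.mul ℝ ℝ = (ContinuousLinearMap.lsmul ℝ ℝ).flip := by
    ext
    simp
  rw [VectorMeasure.withDensity_apply (by simpa [VectorMeasure.Integrable] using hf), hB,
    VectorMeasure.setIntegral_toSignedMeasure hs]

theorem normInv_toSignedMeasure (ν : Measure ℝ) [IsFiniteMeasure ν] :
    normInv ν.toSignedMeasure = (∫⁻ t, ‖t‖ₑ⁻¹ ∂ν).toReal := by
  rw [normInv, Measure.variation_toSignedMeasure]

theorem normInv_pointMass {x : ℝ} (hx : 0 < x) : normInv (pointMass x) = 1 / x := by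
  rw [pointMass, normInv_toSignedMeasure, lintegral_dirac, ENNReal.toReal_inv, toReal_enorm,
    Real.norm_of_nonneg hx.le, one_div]

theorem tilde_pointMass_one : tilde (pointMass 1) = pointMass 1 := by
  ext s hs
  have : Integrable (fun t : ℝ => 1 / (t * 1)) (Measure.dirac 1) :=
    integrable_dirac (by finiteness)
  rw [tilde, normInv_pointMass one_pos, div_one, pointMass, signed_withDensity_apply this hs,
    ← integral_indicator hs, integral_dirac, Measure.toSignedMeasure_apply_measurable hs,
    measureReal_def, Measure.dirac_apply]
  by_cases h1 : (1 : ℝ) ∈ s <;> simp [h1]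

/-- The weight 1/t cancels the density t / r, since σ lives on (0, ∞). -/
theorem normInv_timesId {r : ℝ} (hr : 0 < r) {σ : Measure ℝ} (h : σ (Set.Iic 0) = 0)
    [IsFiniteMeasure (timesId r σ)] :
    normInv (timesId r σ).toSignedMeasure = σ.real Set.univ / r := by
  rw [normInv_toSignedMeasure, timesId, lintegral_withDensity_eq_lintegral_mul _ (by fun_prop)
    (by fun_prop)]
  have : ∫⁻ t, ((fun t => ENNReal.ofReal (t / r)) * fun t : ℝ => ‖t‖ₑ⁻¹) t ∂σ
      = ∫⁻ _, ENNReal.ofReal (1 / r) ∂σ := by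
    refine lintegral_congr_ae ?_
    filter_upwards [ae_pos_of_measure_Iic h] with t ht
    rw [Pi.mul_apply, Real.enorm_of_nonneg ht.le, ← ENNReal.ofReal_inv_of_pos ht,
      ← ENNReal.ofReal_mul (by positivity)]
    congr 1
    field_simp
  rw [this, lintegral_const, ENNReal.toReal_mul, ENNReal.toReal_ofReal (by positivity),
    ← measureReal_def]
  ring

/-- Up to normalization `tilde` undoes `timesId`; this recovers σ from ψ. -/
theorem smul_tilde_timesId {r : ℝ} (hr : 0 < r) {σ : Measure ℝ} [IsFiniteMeasure σ]
    (h : σ (Set.Iic 0) = 0) [IsFiniteMeasure (timesId r σ)] :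
    (r * normInv (timesId r σ).toSignedMeasure) • tilde (timesId r σ).toSignedMeasure
      = σ.toSignedMeasure := by
  set n := normInv (timesId r σ).toSignedMeasure with hn
  have hn' : r * n = σ.real Set.univ := by
    rw [hn, normInv_timesId hr h]
    field_simp
  have hae : ∀ᵐ t ∂σ, t / r * (1 / (t * n)) = 1 / (r * n) := by
    filter_upwards [ae_pos_of_measure_Iic h] with t ht
    rw [div_mul_div_comm, mul_one, show r * (t * n) = t * (r * n) by ring,
      div_mul_cancel_left₀ ht.ne', one_div]
  have hint : Integrable (fun t : ℝ => 1 / (t * n)) (timesId r σ) := by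
    rw [timesId, integrable_withDensity_iff_integrable_smul' (by fun_prop)
      (Filter.Eventually.of_forall fun _ => ENNReal.ofReal_lt_top)]
    refine (integrable_const (1 / (r * n))).congr ?_
    filter_upwards [hae, ae_pos_of_measure_Iic h] with t ht htpos
    rw [ENNReal.toReal_ofReal (by positivity), smul_eq_mul, ht]
  ext s hs
  rw [smul_apply, tilde, signed_withDensity_apply hint hs,
    setIntegral_timesId hr h _ hs, integral_congr_ae (ae_restrict_of_ae hae), setIntegral_const,
    Measure.toSignedMeasure_apply_measurable hs, smul_eq_mul, smul_eq_mul, hn']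
  -- If σ has mass 0, the quotient 1 / 0 is 0 by convention and both sides vanish.
  rcases eq_or_ne (σ.real Set.univ) 0 with h0 | h0
  · have : σ.real s ≤ σ.real Set.univ := measureReal_mono (Set.subset_univ s)
    have : σ.real s = 0 := le_antisymm (h0 ▸ this) measureReal_nonneg
    simp [this]
  · field_simp

/-- The singletons {0} and {1} give one direction; additivity on these disjoint atoms and positivity
of ξ give the other, whatever the signs of e and c. -/
theorem smul_pointMass_add_le_iff (ξ : Measure ℝ) [IsFiniteMeasure ξ] (e c : ℝ) :
    e • pointMass 0 + c • pointMass 1 ≤ ξ.toSignedMeasure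
      ↔ e ≤ ξ.real {0} ∧ c ≤ ξ.real {1} := by
  have happ : ∀ s, MeasurableSet s → (e • pointMass 0 + c • pointMass 1) s
      = e * s.indicator 1 0 + c * s.indicator 1 1 := by
    intro s hs
    by_cases m0 : (0 : ℝ) ∈ s <;> by_cases m1 : (1 : ℝ) ∈ s <;>
      simp [pointMass, hs, measureReal_def, m0, m1]
  constructor
  · intro h
    have h0 := h {0} (measurableSet_singleton _)
    have h1 := h {1} (measurableSet_singleton _)
    rw [happ _ (measurableSet_singleton _),
      Measure.toSignedMeasure_apply_measurable (measurableSet_singleton _)] at h0 h1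
    simpa using And.intro h0 h1
  · rintro ⟨h0, h1⟩ s hs
    rw [happ _ hs, Measure.toSignedMeasure_apply_measurable hs]
    have hsing : ∀ x ∈ s, ξ.real {x} ≤ ξ.real s := fun x hx =>
      measureReal_mono (Set.singleton_subset_iff.2 hx)
    have hnn : 0 ≤ ξ.real s := measureReal_nonneg
    by_cases m0 : (0 : ℝ) ∈ s <;> by_cases m1 : (1 : ℝ) ∈ s <;> simp only [m0, m1,
      Set.indicator_of_mem, Set.indicator_of_notMem, not_false_eq_true, Pi.one_apply, mul_one,
      mul_zero, add_zero, zero_add]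
    · have h2 : ξ.real ({0} ∪ {1}) = ξ.real {0} + ξ.real {1} :=
        measureReal_union (by simp) (measurableSet_singleton _)
      have h3 : ξ.real ({0} ∪ {1}) ≤ ξ.real s :=
        measureReal_mono (by rintro x (rfl | rfl) <;> assumption)
      linarith
    · linarith [hsing 0 m0]
    · linarith [hsing 1 m1]
    · exact hnn

/-! ### The candidate Berger measure -/

/-- The measure `τ × δ₀ + δ₀ × σ + c δ_(1,d)`, carried by the axes and one further point. -/
def crossMeasure (τ σ : Measure ℝ) (c d : ℝ) : Measure (ℝ × ℝ) :=
  τ.prod (Measure.dirac 0) + (Measure.dirac 0).prod σ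
    + ENNReal.ofReal c • (Measure.dirac 1).prod (Measure.dirac d)

instance isFiniteMeasure_crossMeasure (τ σ : Measure ℝ) [IsFiniteMeasure τ] [IsFiniteMeasure σ]
    (c d : ℝ) : IsFiniteMeasure (crossMeasure τ σ c d) := by
  have : IsFiniteMeasure
      (ENNReal.ofReal c • (Measure.dirac (1 : ℝ)).prod (Measure.dirac d)) :=
    Measure.smul_finite _ ENNReal.ofReal_ne_top
  unfold crossMeasure
  infer_instance

theorem crossMeasure_real_prod (τ σ : Measure ℝ) [IsFiniteMeasure τ] [IsFiniteMeasure σ]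
    {c : ℝ} (hc : 0 ≤ c) (d : ℝ) (A B : Set ℝ) :
    (crossMeasure τ σ c d).real (A ×ˢ B) = τ.real A * (Measure.dirac 0).real B
      + (Measure.dirac 0).real A * σ.real B
      + c * ((Measure.dirac 1).real A * (Measure.dirac d).real B) := by
  have : IsFiniteMeasure
      (ENNReal.ofReal c • (Measure.dirac (1 : ℝ)).prod (Measure.dirac d)) :=
    Measure.smul_finite _ ENNReal.ofReal_ne_top
  rw [crossMeasure, measureReal_add_apply, measureReal_add_apply, measureReal_ennreal_smul_apply,
    measureReal_prod_prod, measureReal_prod_prod, measureReal_prod_prod, ENNReal.toReal_ofReal hc]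

theorem crossMeasure_compl_eq_zero {τ σ : Measure ℝ} [SFinite τ] [SFinite σ] {c d : ℝ}
    {A B : Set ℝ} (hτ : τ Aᶜ = 0) (hσ : σ Bᶜ = 0) (hA0 : 0 ∈ A) (hB0 : 0 ∈ B) (hA1 : 1 ∈ A)
    (hBd : d ∈ B) (hA : MeasurableSet A) (hB : MeasurableSet B) :
    crossMeasure τ σ c d (A ×ˢ B)ᶜ = 0 := by
  have key : ∀ (ρ κ : Measure ℝ) [SFinite ρ] [SFinite κ], ρ Aᶜ = 0 → κ Bᶜ = 0 →
      ρ.prod κ (A ×ˢ B)ᶜ = 0 := by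
    intro ρ κ _ _ h1 h2
    have h1' : ∀ᵐ s ∂ρ, s ∈ A := h1
    have h2' : ∀ᵐ t ∂κ, t ∈ B := h2
    filter_upwards [Measure.quasiMeasurePreserving_fst.ae h1',
      Measure.quasiMeasurePreserving_snd.ae h2'] with p hp1 hp2 using ⟨hp1, hp2⟩
  have hdirac : ∀ (x : ℝ) (C : Set ℝ), MeasurableSet C → x ∈ C → Measure.dirac x Cᶜ = 0 := by
    intro x C hC hx
    simp [Measure.dirac_apply' _ hC.compl, hx]
  rw [crossMeasure, Measure.add_apply, Measure.add_apply, Measure.smul_apply,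
    key _ _ hτ (hdirac 0 B hB hB0), key _ _ (hdirac 0 A hA hA0) hσ,
    key _ _ (hdirac 1 A hA hA1) (hdirac d B hB hBd)]
  simp

theorem integral_crossMeasure {τ σ : Measure ℝ} [IsFiniteMeasure τ] [IsFiniteMeasure σ]
    {c : ℝ} (hc : 0 ≤ c) (d : ℝ) {f g : ℝ → ℝ} (hf : Integrable f τ) (hg : Integrable g σ) :
    ∫ p, f p.1 * g p.2 ∂crossMeasure τ σ c d
      = (∫ s, f s ∂τ) * g 0 + f 0 * ∫ t, g t ∂σ + c * (f 1 * g d) := by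
  have hd : ∀ (h : ℝ → ℝ) (x : ℝ), Integrable h (Measure.dirac x) := fun h x =>
    integrable_dirac (by finiteness)
  have i1 := hf.mul_prod (hd g 0)
  have i2 := (hd f 0).mul_prod hg
  have i3 := ((hd f 1).mul_prod (hd g d)).smul_measure (c := ENNReal.ofReal c)
    ENNReal.ofReal_ne_top
  rw [crossMeasure, integral_add_measure (i1.add_measure i2) i3, integral_add_measure i1 i2,
    integral_smul_measure, integral_prod_mul, integral_prod_mul, integral_prod_mul]
  simp [ENNReal.toReal_ofReal hc]

/-- The measure assembled from splittings of the two marginals has the moments of the shift. -/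
theorem integral_monomial_crossMeasure {ξ η τ σ : Measure ℝ} [IsProbabilityMeasure ξ]
    [IsProbabilityMeasure η] [IsFiniteMeasure τ] [IsFiniteMeasure σ] {M N c d : ℝ}
    {γ : ℕ × ℕ → ℝ} (hξ : ξ (Set.Icc 0 M)ᶜ = 0) (hη : η (Set.Icc 0 N)ᶜ = 0) (hc : 0 ≤ c)
    (hc' : c ≤ η.real (Set.Ioi 0))
    (hσ : σ + ENNReal.ofReal c • Measure.dirac d = η.restrict (Set.Ioi 0))
    (hτ : τ + ENNReal.ofReal (η.real (Set.Ioi 0) - c) • Measure.dirac 0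
      + ENNReal.ofReal c • Measure.dirac 1 = ξ)
    (hrow : ∀ i : ℕ, ∫ s, s ^ i ∂ξ = γ (i, 0))
    (hcol : ∀ j : ℕ, ∫ t, t ^ j ∂η = γ (0, j))
    (hcore : ∀ i j : ℕ, γ (i + 1, j + 1) = c * d ^ (j + 1)) (k : ℕ × ℕ) :
    ∫ p, p.1 ^ k.1 * p.2 ^ k.2 ∂crossMeasure τ σ c d = γ k := by
  have he : 0 ≤ η.real (Set.Ioi 0) - c := sub_nonneg.2 hc'
  have iξ : ∀ i : ℕ, Integrable (fun s : ℝ => s ^ i) ξ := fun i =>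
    integrable_of_continuous_of_support hξ (by fun_prop)
  have iη : ∀ i : ℕ, Integrable (fun s : ℝ => s ^ i) η := fun i =>
    integrable_of_continuous_of_support hη (by fun_prop)
  have iη' : ∀ i : ℕ, Integrable (fun s : ℝ => s ^ i) (η.restrict (Set.Ioi 0)) := fun i =>
    (iη i).restrict
  have iτ' : ∀ i : ℕ, Integrable (fun s : ℝ => s ^ i)
      (τ + ENNReal.ofReal (η.real (Set.Ioi 0) - c) • Measure.dirac 0) := fun i => by
    have := iξ i
    rw [← hτ] at this
    exact this.left_of_add_measure
  have iτ : ∀ i : ℕ, Integrable (fun s : ℝ => s ^ i) τ := fun i => (iτ' i).left_of_add_measure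
  have iσ : ∀ i : ℕ, Integrable (fun s : ℝ => s ^ i) σ := fun i => by
    have := iη' i
    rw [← hσ] at this
    exact this.left_of_add_measure
  have eξ : ∀ i : ℕ, γ (i, 0) = ∫ s, s ^ i ∂τ + (η.real (Set.Ioi 0) - c) * 0 ^ i + c := by
    intro i
    have h1 := integral_eq_of_add_dirac_eq hc hτ (iξ i)
    have h2 := integral_eq_of_add_dirac_eq he rfl (iτ' i)
    rw [← hrow, h1, h2]
    simp
  have eη : ∀ j : ℕ, ∫ t in Set.Ioi 0, t ^ j ∂η = ∫ t, t ^ j ∂σ + c * d ^ j := fun j =>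
    integral_eq_of_add_dirac_eq hc hσ (iη' j)
  obtain ⟨i, j⟩ := k
  rw [integral_crossMeasure (f := fun s => s ^ i) (g := fun t => t ^ j) hc d (iτ i) (iσ j)]
  rcases i with _ | i
  · rcases j with _ | j
    · have h0 := eξ 0
      have h1 := eη 0
      simp at h0 h1 ⊢
      linarith
    · have h1 := eη (j + 1)
      -- A positive power of t vanishes at 0, so restricting η to (0, ∞) does not change the moment.
      rw [setIntegral_eq_integral_of_ae_compl_eq_zero, hcol] at h1
      · simp [h1]
      · filter_upwards [ae_mem_of_compl_eq_zero hη] with t ht hn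
        rw [le_antisymm (not_lt.1 hn) ht.1]
        simp
  · rcases j with _ | j
    · have h0 := eξ (i + 1)
      simp at h0 ⊢
      linarith
    · rw [hcore]
      simp

theorem restrict_Ioi_Iic_eq_zero (η : Measure ℝ) : η.restrict (Set.Ioi 0) (Set.Iic 0) = 0 := by
  rw [Measure.restrict_apply measurableSet_Iic, (Set.Iic_disjoint_Ioi le_rfl).inter_eq,
    measure_empty]

/-! ### Identification of ψ, φ and the measure formula -/

/-- The Berger measure of the tail of a shift has density `t / w₀²`. -/
theorem eq_timesId_of_isBergerMeasure {w : Weights ℕ} {η η₁ : ProbabilityMeasure ℝ}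
    (h : IsBergerMeasure w η) (h₁ : IsBergerMeasure (w.reindex fun n => n + 1) η₁) :
    (η₁ : Measure ℝ) = timesId (w 0 ^ 2) ((η : Measure ℝ).restrict (Set.Ioi 0)) := by
  have hr : 0 < w 0 ^ 2 := pow_pos (w.pos 0) 2
  have hIic := restrict_Ioi_Iic_eq_zero (η : Measure ℝ)
  have hsupp : (η : Measure ℝ).restrict (Set.Ioi 0) (Set.Icc 0 (‖uniShift w‖ ^ 2))ᶜ = 0 :=
    Measure.restrict_le_self.absolutelyContinuous h.1
  have := isFiniteMeasure_timesId (w 0 ^ 2) hsupp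
  refine eq_of_forall_moment_eq_real h₁.1 (withDensity_absolutelyContinuous _ _ hsupp) fun i => ?_
  rw [h₁.2, ← setIntegral_univ, setIntegral_timesId hr hIic _ MeasurableSet.univ, setIntegral_univ]
  have e : ∀ t : ℝ, t / w 0 ^ 2 * t ^ i = t ^ (i + 1) * (w 0 ^ 2)⁻¹ := fun t => by
    rw [pow_succ, div_eq_mul_inv]; ring
  simp only [e]
  rw [integral_mul_const, setIntegral_eq_integral_of_ae_compl_eq_zero, h.2,
    Finset.prod_range_succ']
  · exact (mul_inv_cancel_right₀ hr.ne' _).symm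
  · filter_upwards [ae_mem_of_compl_eq_zero h.1] with t ht hn
    rw [le_antisymm (not_lt.1 hn) ht.1]
    simp

/-- The density t / r turns an atom c at d into an atom c d / r = a², which is exactly what ψ
subtracts from (η_y)₁. -/
theorem psi_eq_timesId {η σ : Measure ℝ} [IsFiniteMeasure σ] {η₁ : ProbabilityMeasure ℝ}
    {a c d r : ℝ} (hc : 0 ≤ c) (ha : c * d / r = a ^ 2)
    [IsFiniteMeasure (timesId r σ)] (hη₁ : (η₁ : Measure ℝ) = timesId r η)
    (hσ : σ + ENNReal.ofReal c • Measure.dirac d = η) :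
    psi a (toSigned η₁) (pointMass 1) (pointMass d) = (timesId r σ).toSignedMeasure := by
  ext s hs
  have h : timesId r σ + ENNReal.ofReal (a ^ 2) • Measure.dirac d = η₁ := by
    rw [hη₁, ← hσ, timesId_add_dirac _ _ _ _ hc, ha]
  rw [psi, normInv_pointMass one_pos, toSigned, pointMass, sub_apply, smul_apply,
    Measure.toSignedMeasure_apply_measurable hs, Measure.toSignedMeasure_apply_measurable hs,
    Measure.toSignedMeasure_apply_measurable hs,
    measureReal_eq_of_add_dirac_eq (sq_nonneg a) h s]
  simp

/-- Evaluating ψ at {d}, where η₁ has mass (d / r) η({d}), gives the bound. -/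
theorem le_atom_of_psi_nonneg {η : Measure ℝ} {η₁ : ProbabilityMeasure ℝ}
    {a d r : ℝ} (hd : 0 < d) (hr : 0 < r)
    (hη₁ : (η₁ : Measure ℝ) = timesId r (η.restrict (Set.Ioi 0)))
    (h : 0 ≤ psi a (toSigned η₁) (pointMass 1) (pointMass d)) :
    a ^ 2 * r / d ≤ η.real {d} := by
  have h1 := h {d} (measurableSet_singleton d)
  have hIic := restrict_Ioi_Iic_eq_zero η
  have h2 : (η₁ : Measure ℝ).real {d} = d / r * η.real {d} := by
    have h3 := setIntegral_timesId hr hIic (fun _ => 1) (measurableSet_singleton d)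
    rw [← hη₁, setIntegral_const, Measure.restrict_restrict (measurableSet_singleton d),
      Set.singleton_inter_of_mem (show d ∈ Set.Ioi 0 from hd), integral_singleton] at h3
    simpa [mul_comm] using h3
  rw [psi, normInv_pointMass one_pos, toSigned, pointMass, sub_apply, smul_apply,
    Measure.toSignedMeasure_apply_measurable (measurableSet_singleton d),
    Measure.toSignedMeasure_apply_measurable (measurableSet_singleton d), h2] at h1
  simp [measureReal_def] at h1
  rw [← measureReal_def] at h1
  rw [div_le_iff₀ hd]
  rw [div_mul_eq_mul_div, le_div_iff₀ hr] at h1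
  linarith

theorem phi_eq {ξ : ProbabilityMeasure ℝ} {ψ : SignedMeasure ℝ} {a y₀ c d e : ℝ} (hd : 0 < d)
    (he : y₀ ^ 2 * normInv ψ = e) (hc : a ^ 2 * y₀ ^ 2 / d = c) :
    phi a y₀ (toSigned ξ) ψ (pointMass 1) (pointMass d)
      = toSigned ξ - (e • pointMass 0 + c • pointMass 1) := by
  rw [phi, he, normInv_pointMass one_pos, normInv_pointMass hd, tilde_pointMass_one, ← hc,
    sub_sub]
  congr 3
  field_simp

/-- The signed-measure formula for the assembled measure. -/
theorem toSigned_eq_of_splitting {τ σ : Measure ℝ} [IsFiniteMeasure τ] [IsFiniteMeasure σ]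
    {ξ : ProbabilityMeasure ℝ} {μ : ProbabilityMeasure (ℝ × ℝ)} {c d e : ℝ}
    {κ : SignedMeasure ℝ} (hc : 0 ≤ c) (he : 0 ≤ e) (hκ : e • κ = σ.toSignedMeasure)
    (hτ : τ + ENNReal.ofReal e • Measure.dirac 0 + ENNReal.ofReal c • Measure.dirac 1 = (ξ : Measure ℝ))
    (hμ : (μ : Measure (ℝ × ℝ)) = crossMeasure τ σ c d) :
    toSigned μ = times (toSigned ξ - (e • pointMass 0 + c • pointMass 1))
        (pointMass 0 - pointMass d)
      + e • times (pointMass 0) (κ - pointMass d) + times (toSigned ξ) (pointMass d) := by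
  -- Rectangles determine a signed measure. On them, ξ - e δ₀ - c δ₁ = τ and e κ = σ; all terms with
  -- δ_d cancel except c δ₁ × δ_d.
  have hrect : ∀ A B : Set ℝ, MeasurableSet A → MeasurableSet B →
      toSigned μ (A ×ˢ B) = (times (toSigned ξ - (e • pointMass 0 + c • pointMass 1))
        (pointMass 0 - pointMass d) + e • times (pointMass 0) (κ - pointMass d)
          + times (toSigned ξ) (pointMass d)) (A ×ˢ B) := by
    intro A B hA hB
    have hfin : IsFiniteMeasure (ENNReal.ofReal e • Measure.dirac (0 : ℝ)) :=
      Measure.smul_finite _ ENNReal.ofReal_ne_top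
    have h1 := measureReal_eq_of_add_dirac_eq hc hτ A
    rw [measureReal_eq_of_add_dirac_eq he rfl A] at h1
    have h2 : e * κ B = σ.real B := by
      have := congrArg (fun ν => ν B) hκ
      simpa [hB] using this
    have h3 : toSigned μ (A ×ˢ B) = (crossMeasure τ σ c d).real (A ×ˢ B) := by
      rw [toSigned, Measure.toSignedMeasure_apply_measurable (hA.prod hB), hμ]
    rw [h3, crossMeasure_real_prod _ _ hc, ← h2]
    simp only [add_apply, sub_apply, smul_apply, smul_eq_mul, times_apply, toSigned,
      pointMass, Measure.toSignedMeasure_apply_measurable hA,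
      Measure.toSignedMeasure_apply_measurable hB, h1]
    ring
  refine VectorMeasure.ext_of_generateFrom _ ?_ generateFrom_prod.symm isPiSystem_prod ?_
  · rintro _ ⟨A, hA, B, hB, rfl⟩
    exact hrect A B hA hB
  · rw [← Set.univ_prod_univ]
    exact hrect _ _ MeasurableSet.univ MeasurableSet.univ

theorem le_div_mul_sqrt_iff {a b y m : ℝ} (ha : 0 < a) (hb : 0 < b) (hy : 0 < y) :
    y ≤ b / a * √m ↔ a ^ 2 * y ^ 2 / b ^ 2 ≤ m := by
  have h1 : y ≤ b / a * √m ↔ a * y / b ≤ √m := by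
    rw [div_mul_eq_mul_div, le_div_iff₀ ha, div_le_iff₀ hb, mul_comm y a, mul_comm b]
  rw [h1, Real.le_sqrt' (by positivity), div_pow, mul_pow]

end

/-! ### The equivalence and the Berger measure -/

theorem proposition3p1 (α β : Weights (ℕ × ℕ))
    (hαflat : IsHorizontallyFlat α) (hβflat : IsVerticallyFlat β) (hα : α (1, 1) = 1)
    (hT : IsCommutingSubnormals (shiftOne α) (shiftTwo β))
    (a b y₀ : ℝ) (ha : a = α (0, 1)) (hb : b = β (1, 1)) (hy₀ : y₀ = β (0, 0))
    (ξx ηy ηy₁ : ProbabilityMeasure ℝ)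
    (hξx : IsBergerMeasure (α.reindex fun n => (n, 0)) ξx)
    (hηy : IsBergerMeasure (β.reindex fun n => (0, n)) ηy)
    (hηy₁ : IsBergerMeasure (β.reindex fun n => (0, n + 1)) ηy₁)
    (m : ℝ) (hm : m = (ηy : Measure ℝ).real {b ^ 2})
    (ψ φ : SignedMeasure ℝ)
    (hψ : ψ = psi a (toSigned ηy₁) (pointMass 1) (pointMass (b ^ 2)))
    (hφ : φ = phi a y₀ (toSigned ξx) ψ (pointMass 1) (pointMass (b ^ 2))) :
    [IsSubnormalPair (shiftOne α) (shiftTwo β),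
      0 ≤ ψ ∧ 0 ≤ φ,
      y₀ ≤ b / a * √m ∧
        y₀ ^ 2 • ((normInv (toSigned ηy₁) - a ^ 2 / b ^ 2) • pointMass 0
          + (a ^ 2 / b ^ 2) • pointMass 1) ≤ toSigned ξx].TFAE ∧
    (IsSubnormalPair (shiftOne α) (shiftTwo β) →
      ∃ μ : ProbabilityMeasure (ℝ × ℝ), IsBergerMeasureTwo α β μ ∧
        (∀ ν : ProbabilityMeasure (ℝ × ℝ), IsBergerMeasureTwo α β ν → ν = μ) ∧
        toSigned μ = times φ (pointMass 0 - pointMass (b ^ 2))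
          + (y₀ ^ 2 * normInv ψ) • times (pointMass 0) (tilde ψ - pointMass (b ^ 2))
          + times (toSigned ξx) (pointMass (b ^ 2))) := by
  have hcomm := hT.1
  have hapos : 0 < a := ha ▸ α.pos _
  have hbpos : 0 < b := hb ▸ β.pos _
  have hypos : 0 < y₀ := hy₀ ▸ β.pos _
  have hd : 0 < b ^ 2 := by positivity
  have hr : 0 < y₀ ^ 2 := by positivity
  -- The mass at (1, b²) dictated by the moments off the axes.
  obtain ⟨c, hc⟩ : ∃ c, c = a ^ 2 * y₀ ^ 2 / b ^ 2 := ⟨_, rfl⟩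
  have hcpos : 0 < c := by rw [hc]; positivity
  have hrow : ∀ i : ℕ, ∫ s, s ^ i ∂(ξx : Measure ℝ) = moment α β (i, 0) := fun i => by
    rw [hξx.2, moment_row_zero]; rfl
  have hcol : ∀ j : ℕ, ∫ t, t ^ j ∂(ηy : Measure ℝ) = moment α β (0, j) := fun j => by
    rw [hηy.2, moment_column_zero]; rfl
  have hcore : ∀ i j : ℕ, moment α β (i + 1, j + 1) = c * (b ^ 2) ^ (j + 1) := fun i j => by
    rw [moment_core hαflat hβflat hα hcomm, hc, ha, hb, hy₀]
  have hηy₁' : (ηy₁ : Measure ℝ)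
      = timesId (y₀ ^ 2) ((ηy : Measure ℝ).restrict (Set.Ioi 0)) := by
    rw [eq_timesId_of_isBergerMeasure hηy hηy₁, hy₀]; rfl
  -- The mass left for the open vertical axis.
  obtain ⟨e, he⟩ : ∃ e, e = (ηy : Measure ℝ).real (Set.Ioi 0) - c := ⟨_, rfl⟩
  have hηsupp : (ηy : Measure ℝ).restrict (Set.Ioi 0)
      (Set.Icc 0 (‖uniShift (β.reindex fun n => (0, n))‖ ^ 2))ᶜ = 0 :=
    Measure.restrict_le_self.absolutelyContinuous hηy.1
  have hnormInv : normInv (toSigned ηy₁) = (ηy : Measure ℝ).real (Set.Ioi 0) / y₀ ^ 2 := by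
    have := isFiniteMeasure_timesId (y₀ ^ 2) hηsupp
    have h := normInv_timesId hr (restrict_Ioi_Iic_eq_zero (ηy : Measure ℝ))
    rw [measureReal_restrict_apply MeasurableSet.univ, Set.univ_inter] at h
    rw [← h, toSigned]
    congr 1
    exact (Measure.toSignedMeasure_congr hηy₁')
  have hle : (ηy : Measure ℝ).real {b ^ 2} ≤ (ηy : Measure ℝ).real (Set.Ioi 0) :=
    measureReal_mono (Set.singleton_subset_iff.2 hd)
  -- The norm in φ uses the total variation of ψ, so its value is computed only after c ≤ m has made
  -- ψ positive.
  have hsplit : c ≤ m → ∃ (σ : Measure ℝ) (_ : IsFiniteMeasure σ),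
      σ + ENNReal.ofReal c • Measure.dirac (b ^ 2) = (ηy : Measure ℝ).restrict (Set.Ioi 0) ∧
      0 ≤ ψ ∧ y₀ ^ 2 * normInv ψ = e ∧ e • tilde ψ = σ.toSignedMeasure := by
    intro hcm
    obtain ⟨σ, hσfin, hσ⟩ := exists_add_dirac_eq ((ηy : Measure ℝ).restrict (Set.Ioi 0))
      (x := b ^ 2) hcpos.le (by
        rw [measureReal_restrict_apply (measurableSet_singleton _),
          Set.singleton_inter_of_mem (show b ^ 2 ∈ Set.Ioi 0 from hd), ← hm]
        exact hcm)
    have hσIic := measure_eq_zero_of_add_eq hσ (restrict_Ioi_Iic_eq_zero (ηy : Measure ℝ))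
    have hfin := isFiniteMeasure_timesId (y₀ ^ 2) (measure_eq_zero_of_add_eq hσ hηsupp)
    have hψ' : ψ = (timesId (y₀ ^ 2) σ).toSignedMeasure := by
      rw [hψ, psi_eq_timesId hcpos.le (by rw [hc]; field_simp) hηy₁' hσ]
    have hn : y₀ ^ 2 * normInv ψ = e := by
      have h := measureReal_eq_of_add_dirac_eq hcpos.le hσ Set.univ
      rw [measureReal_restrict_apply MeasurableSet.univ, Set.univ_inter] at h
      rw [hψ', normInv_timesId hr hσIic, mul_div_cancel₀ _ hr.ne', he, h]
      simp
    refine ⟨σ, hσfin, hσ, ?_, hn, ?_⟩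
    · rw [hψ']
      exact Measure.zero_le_toSignedMeasure _
    · rw [← hn, hψ']
      exact smul_tilde_timesId hr hσIic
  have hφ' : c ≤ m → φ = toSigned ξx - (e • pointMass 0 + c • pointMass 1) := fun hcm => by
    obtain ⟨σ, -, -, -, hn, -⟩ := hsplit hcm
    rw [hφ, phi_eq hd hn hc.symm]
  have hii : (0 ≤ ψ ∧ 0 ≤ φ)
      ↔ c ≤ m ∧ e ≤ (ξx : Measure ℝ).real {0} ∧ c ≤ (ξx : Measure ℝ).real {1} := by
    constructor
    · rintro ⟨h1, h2⟩
      have hcm : c ≤ m := by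
        rw [hc, hm]
        exact le_atom_of_psi_nonneg hd hr hηy₁' (hψ ▸ h1)
      refine ⟨hcm, (smul_pointMass_add_le_iff _ e c).1 ?_⟩
      rw [hφ' hcm] at h2
      exact sub_nonneg.1 h2
    · rintro ⟨hcm, h⟩
      obtain ⟨σ, -, -, hψ0, -, -⟩ := hsplit hcm
      refine ⟨hψ0, ?_⟩
      rw [hφ' hcm]
      exact sub_nonneg.2 ((smul_pointMass_add_le_iff _ e c).2 h)
  have hiii : (y₀ ≤ b / a * √m ∧
        y₀ ^ 2 • ((normInv (toSigned ηy₁) - a ^ 2 / b ^ 2) • pointMass 0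
          + (a ^ 2 / b ^ 2) • pointMass 1) ≤ toSigned ξx)
      ↔ c ≤ m ∧ e ≤ (ξx : Measure ℝ).real {0} ∧ c ≤ (ξx : Measure ℝ).real {1} := by
    have e1 : y₀ ^ 2 * (normInv (toSigned ηy₁) - a ^ 2 / b ^ 2) = e := by
      rw [hnormInv, he, hc]
      field_simp
    have e2 : y₀ ^ 2 * (a ^ 2 / b ^ 2) = c := by
      rw [hc]
      ring
    rw [smul_add, smul_smul, smul_smul, e1, e2, le_div_mul_sqrt_iff hapos hbpos hypos, ← hc]
    exact and_congr_right' (smul_pointMass_add_le_iff _ e c)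
  have hnec : IsSubnormalPair (shiftOne α) (shiftTwo β) →
      c ≤ m ∧ e ≤ (ξx : Measure ℝ).real {0} ∧ c ≤ (ξx : Measure ℝ).real {1} := by
    intro hsub
    obtain ⟨h1, h2, h3⟩ := atoms_of_isSubnormalPair hξx.1 hηy.1 hd hrow hcol hcore hsub
    refine ⟨hm ▸ h1, ?_, h2⟩
    -- Since η_y lives on [0, ∞), this turns 1 - c ≤ ξ_x({0}) + η_y({0}) into e ≤ ξ_x({0}).
    have h4 : (ηy : Measure ℝ).real {0} + (ηy : Measure ℝ).real (Set.Ioi 0) = 1 := by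
      rw [← measureReal_union (by simp) measurableSet_Ioi, ← probReal_univ (μ := (ηy : Measure ℝ))]
      refine measureReal_congr ?_
      filter_upwards [ae_mem_of_compl_eq_zero hηy.1] with t ht
      have : t ∈ ({0} ∪ Set.Ioi 0 : Set ℝ) := ht.1.eq_or_lt.imp (fun h => h.symm) id
      exact propext ⟨fun _ => trivial, fun _ => this⟩
    linarith
  have hα1 : 1 ≤ ‖shiftOne α‖ ^ 2 :=
    one_le_pow₀ (hα ▸ weight_le_norm_weightedShift α eastEmb (1, 1))
  have hβ1 : b ^ 2 ≤ ‖shiftTwo β‖ ^ 2 :=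
    pow_le_pow_left₀ hbpos.le (hb ▸ weight_le_norm_weightedShift β northEmb (1, 1)) 2
  have hex : c ≤ m ∧ e ≤ (ξx : Measure ℝ).real {0} ∧ c ≤ (ξx : Measure ℝ).real {1} →
      ∃ μ : ProbabilityMeasure (ℝ × ℝ), IsBergerMeasureTwo α β μ ∧
        toSigned μ = times φ (pointMass 0 - pointMass (b ^ 2))
          + (y₀ ^ 2 * normInv ψ) • times (pointMass 0) (tilde ψ - pointMass (b ^ 2))
          + times (toSigned ξx) (pointMass (b ^ 2)) := by
    rintro ⟨hcm, he0, hc1⟩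
    obtain ⟨σ, hσfin, hσ, -, hn, hψσ⟩ := hsplit hcm
    have hepos : 0 ≤ e := by
      rw [he, sub_nonneg]
      exact hcm.trans (hm ▸ hle)
    obtain ⟨τ', hτ'fin, hτ'⟩ := exists_add_dirac_eq (ξx : Measure ℝ) hcpos.le hc1
    -- Removing c δ₁ leaves the atom at 0 untouched, so e δ₀ can still be split off.
    obtain ⟨τ, hτfin, hτ⟩ := exists_add_dirac_eq τ' hepos (x := 0) (by
      have := measureReal_eq_of_add_dirac_eq hcpos.le hτ' {0}
      have h0 : (Measure.dirac (1 : ℝ)).real {0} = 0 := by simp [measureReal_def]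
      rw [h0, mul_zero, add_zero] at this
      rwa [← this])
    have hτξ : τ + ENNReal.ofReal e • Measure.dirac 0 + ENNReal.ofReal c • Measure.dirac 1
        = (ξx : Measure ℝ) := by rw [hτ, hτ']
    have hmom := integral_monomial_crossMeasure hξx.1 hηy.1 hcpos.le (by
      linarith [he]) hσ (he ▸ hτξ) hrow hcol hcore
    have hprob : IsProbabilityMeasure (crossMeasure τ σ c (b ^ 2)) := by
      refine isProbabilityMeasure_iff_real.2 ?_
      simpa [moment] using hmom (0, 0)
    refine ⟨⟨crossMeasure τ σ c (b ^ 2), hprob⟩, ⟨?_, hmom⟩, ?_⟩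
    · refine crossMeasure_compl_eq_zero ?_ ?_ ?_ ?_ ?_ ?_ measurableSet_Icc measurableSet_Icc
      · refine measure_mono_null (Set.compl_subset_compl.2 (Set.Icc_subset_Icc_right ?_))
          (measure_eq_zero_of_add_eq hτ (measure_eq_zero_of_add_eq hτ' hξx.1))
        exact pow_le_pow_left₀ (norm_nonneg _) (norm_uniShift_row_le α 0) 2
      · refine measure_mono_null (Set.compl_subset_compl.2 (Set.Icc_subset_Icc_right ?_))
          (measure_eq_zero_of_add_eq hσ hηsupp)
        exact pow_le_pow_left₀ (norm_nonneg _) (norm_uniShift_column_le β 0) 2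
      · exact ⟨le_rfl, sq_nonneg _⟩
      · exact ⟨le_rfl, sq_nonneg _⟩
      · exact ⟨zero_le_one, hα1⟩
      · exact ⟨hd.le, hβ1⟩
    · rw [hn, hφ' hcm]
      exact toSigned_eq_of_splitting hcpos.le hepos hψσ hτξ rfl
  refine ⟨?_, fun hsub => ?_⟩
  · tfae_have 1 → 2 := fun h => hii.2 (hnec h)
    tfae_have 2 → 3 := fun h => hiii.2 (hii.1 h)
    tfae_have 3 → 1 := fun h => by
      obtain ⟨μ, hμ, -⟩ := hex (hiii.1 h)
      exact isSubnormalPair_of_moments hcomm μ hμ.1 hμ.2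
    tfae_finish
  · obtain ⟨μ, hμ, hμ'⟩ := hex (hnec hsub)
    refine ⟨μ, hμ, fun ν hν => ?_, hμ'⟩
    have heq : (ν : Measure (ℝ × ℝ)) = μ :=
      eq_of_forall_moment_eq (isCompact_Icc.prod isCompact_Icc) hν.1 hμ.1 fun i j =>
        (hν.2 (i, j)).trans (hμ.2 (i, j)).symm
    exact Subtype.ext heq
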